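/- Let $K$ be a number field, $p$ a prime number, and suppose that $K$ contains no primitive $p$-th root of unity. Let $L=K(\omega)$ with $\omega^p\in K$ not a $p$-th power of an element of $K$; thus $L/K$ is a non-normal radical extension of degree $p$. A Hopf–Galois structure on $L/K$ is a $K$-Hopf algebra $H$ with a $K$-linear action on $L$ making $L$ an $H$-module algebra and such that the map $L\otimes_K H\to \mathrm{End}_K(L)$, $s\otimes h\mapsto (t\mapsto s\,(h\cdot t))$, is bijective; two such structures are identified if there is an isomorphism of $K$-Hopf algebras between them that is compatible with the actions on $L$. Then: 1. $L/K$ admits exactly one Hopf–Galois structure (and its Hopf algebra is finite-dimensional and cocommutative). 2. Let $E=K(\omega,\zeta)$ be the Galois closure of $L/K$, where $\zeta$ is a primitive $p$-th root of unity, let $G=\mathrm{Gal}(E/K)$, $G'=\mathrm{Gal}(E/L)$, $X=G/G'$ (left cosets), and let $\lambda:G\to\mathrm{Perm}(X)$ be left translation. There is $\sigma\in G$ with $\sigma(\omega)=\zeta\omega$ and $\sigma(\zeta)=\zeta$; every element of $X$ is of the form $\bar\sigma^i=\sigma^iG'$ with $i\in\mathbb{Z}$, and there is $\eta\in\mathrm{Perm}(X)$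 with $\eta(\bar\sigma^i)=\bar\sigma^{i-1}$ for all $i\in\mathbb{Z}$. The group $N=\langle\eta\rangle$ is a regular subgroup of $\mathrm{Perm}(X)$ normalized by $\lambda(G)$, and it is the one and only subgroup that corresponds to the unique Hopf–Galois structure on $L/K$. Here a Hopf–Galois structure on $L/K$ corresponds to a regular subgroup $N'\le\mathrm{Perm}(X)$ normalized by $\lambda(G)$ if it is isomorphic to the $K$-Hopf algebra $E[N']^G$ (with operations restricted from the $E$-Hopf algebra $E[N']$, where $G$ acts on $E$ as Galois automorphisms and on $N'$ by ${}^g n=\lambda(g)n\lambda(g)^{-1}$), acting on $L$ by $\bigl(\sum_{n} c_n n\bigr)\cdot y=\sum_{n} c_n\,(n^{-1}[\bar 1_G])(y)$, where $(gG')(y)=g(y)$ for $g\in G$, $y\in L$. -/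

import Mathlib

open scoped TensorProduct

universe u v w w' x

noncomputable section

/-- A Hopf-Galois structure on `L/K`: a `K`-Hopf algebra `H` together with a `K`-linear action of
`H` on `L` that makes `L` an `H`-module algebra and for which the map
`j : L ⊗ H → End_K(L)`, `j(s ⊗ h)(t) = s (h · t)`, is bijective. -/
structure HopfGaloisStructure (K : Type u) (L : Type v) [Field K] [Field L] [Algebra K L] where
  /-- the Hopf algebra -/
  H : Type w
  [ring : Ring H]
  [hopf : HopfAlgebra K H]
  /-- the action of `H` on `L` -/
  act : H →ₐ[K] Module.End K L
  /-- `h · 1 = ε(h) 1` -/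
  act_one : ∀ h : H, act h 1 = algebraMap K L (Coalgebra.counit (R := K) h)
  /-- `h · (s t) = ∑ (h₁ · s) (h₂ · t)` where `Δ(h) = ∑ h₁ ⊗ h₂` -/
  act_mul : ∀ (h : H) (s t : L), act h (s * t) =
    LinearMap.mul' K L
      (TensorProduct.map (LinearMap.applyₗ s ∘ₗ act.toLinearMap)
        (LinearMap.applyₗ t ∘ₗ act.toLinearMap) (Coalgebra.comul (R := K) h))
  /-- the map `s ⊗ h ↦ (t ↦ s (h · t))` is bijective -/
  galois : Function.Bijective
    (LinearMap.mul' K (Module.End K L) ∘ₗ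
      TensorProduct.map (Algebra.lmul K L).toLinearMap act.toLinearMap :
        L ⊗[K] H →ₗ[K] Module.End K L)

attribute [instance] HopfGaloisStructure.ring HopfGaloisStructure.hopf

namespace HopfGaloisStructure

/-- Two Hopf-Galois structures on `L/K` are the same if there is an isomorphism of `K`-Hopf
algebras between them that respects the actions on `L`. (An isomorphism of bialgebras between
Hopf algebras automatically respects antipodes.) -/
def Equivalent {K : Type u} {L : Type v} [Field K] [Field L] [Algebra K L]
    (S : HopfGaloisStructure.{u, v, w} K L) (T : HopfGaloisStructure.{u, v, w'} K L) : Prop :=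
  ∃ e : S.H ≃ₐc[K] T.H, ∀ (h : S.H) (t : L), T.act (e h) t = S.act h t

end HopfGaloisStructure

section GreitherPareigis

variable (K : Type u) (L : Type v) (E : Type x) [Field K] [Field L] [Field E]
  [Algebra K L] [Algebra K E] [Algebra L E] [IsScalarTower K L E]

/-- `G' = Gal(E/L)` as a subgroup of `G = Gal(E/K)`. -/
def galSubgroup : Subgroup (E ≃ₐ[K] E) :=
  (IsScalarTower.toAlgHom K L E).fieldRange.fixingSubgroup

/-- The left coset space `X = G / G'`. -/
abbrev GalCosets : Type x := (E ≃ₐ[K] E) ⧸ galSubgroup K L E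

/-- The left translation map `λ : G → Perm(X)`. -/
def leftTranslation : (E ≃ₐ[K] E) →* Equiv.Perm (GalCosets K L E) :=
  MulAction.toPermHom (E ≃ₐ[K] E) (GalCosets K L E)

variable {K L E}

/-- For a coset `gG'` and `y ∈ L`, the element `g(y)` of `E`. -/
def cosetApply (q : GalCosets K L E) (y : L) : E :=
  Quotient.liftOn' q (fun g : E ≃ₐ[K] E => g (algebraMap L E y)) (by
    intro a b hab
    have h : a⁻¹ * b ∈ galSubgroup K L E := QuotientGroup.leftRel_apply.mp hab
    have h' : (a⁻¹ * b) (algebraMap L E y) = algebraMap L E y :=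
      (IntermediateField.mem_fixingSubgroup_iff _ _).mp h _ ⟨y, rfl⟩
    have h2 : a ((a⁻¹ * b) (algebraMap L E y)) = b (algebraMap L E y) := by
      rw [← AlgEquiv.mul_apply, mul_inv_cancel_left]
    show a (algebraMap L E y) = b (algebraMap L E y)
    rw [← h2, h'])

/-- A subgroup of `Perm(X)` is regular if it acts simply transitively on `X`. -/
def IsRegularSubgroup {X : Type*} (N : Subgroup (Equiv.Perm X)) : Prop :=
  ∀ s t : X, ∃! n : Equiv.Perm X, n ∈ N ∧ n s = t

/-- `N` is normalized by the image of `G` under left translation. -/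
def NormalizedByTranslations (N : Subgroup (Equiv.Perm (GalCosets K L E))) : Prop :=
  ∀ (g : E ≃ₐ[K] E), ∀ n ∈ N,
    leftTranslation K L E g * n * (leftTranslation K L E g)⁻¹ ∈ N

/-- The fixed points `E[N]^G`, where `G` acts on `E` by Galois automorphisms and on `N` by
`g • n = λ(g) n λ(g)⁻¹`. The element `∑ cₙ n` is fixed by `g` if and only if the coefficient at
`λ(g) n λ(g)⁻¹` is `g(cₙ)` for all `n`. -/
def fixedGroupAlgebra (N : Subgroup (Equiv.Perm (GalCosets K L E))) :
    Set (MonoidAlgebra E N) :=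
  {f | ∀ (g : E ≃ₐ[K] E) (n m : N),
    (m : Equiv.Perm (GalCosets K L E)) =
      leftTranslation K L E g * n * (leftTranslation K L E g)⁻¹ → f.coeff m = g (f.coeff n)}

/-- The Hopf-Galois structure `S` corresponds to the subgroup `N` of `Perm(X)` under the
Greither-Pareigis correspondence: `N` is regular and normalized by `λ(G)`, and `S` is, up to
isomorphism, the `K`-Hopf algebra `E[N]^G`, whose operations are restricted from the `E`-Hopf
algebra `E[N]`, acting on `L` by `(∑ cₙ n) · y = ∑ cₙ n⁻¹[1G'](y)`. -/
def HopfGaloisStructure.CorrespondsTo (S : HopfGaloisStructure.{u, v, w} K L)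
    (N : Subgroup (Equiv.Perm (GalCosets K L E))) : Prop :=
  IsRegularSubgroup N ∧ NormalizedByTranslations N ∧
  ∃ φ : S.H →ₐ[K] MonoidAlgebra E N,
    Function.Injective φ ∧
    Set.range φ = fixedGroupAlgebra N ∧
    (∀ h : S.H, Coalgebra.counit (R := E) (φ h) =
      algebraMap K E (Coalgebra.counit (R := K) h)) ∧
    (∀ h : S.H, Coalgebra.comul (R := E) (φ h) =
      TensorProduct.mapOfCompatibleSMul E K K (MonoidAlgebra E N) (MonoidAlgebra E N)
        (TensorProduct.map φ.toLinearMap φ.toLinearMap (Coalgebra.comul (R := K) h))) ∧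
    (∀ (h : S.H) (y : L), algebraMap L E (S.act h y) =
      (φ h).coeff.sum fun n c =>
        c * cosetApply ((n : Equiv.Perm (GalCosets K L E))⁻¹
          (QuotientGroup.mk (1 : E ≃ₐ[K] E))) y)

end GreitherPareigis

end

/-! The powers `ω ^ j` grade `L` by `ZMod p` with one-dimensional components, so the algebra of
functions on `ZMod p` acts diagonally and gives a Hopf–Galois structure. For uniqueness it suffices
that every Hopf–Galois structure is diagonal on these powers: its eigenvalues then identify it with
the function algebra (`exists_bialgEquiv_of_diagonal`).

Diagonality is a descent argument (`exists_fixed_coeff`). Over `E`, the space of `K`-linear maps `L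
→ E` has two bases: one coming from `H`, and the `p` embeddings of `L`. Applying `σ` to coordinates
in the first basis permutes the embeddings, because being an algebra map is a system of equations
over `K` in these coordinates. This permutation has `p`-th power one and fixes the inclusion, so it
is trivial (`eq_of_iterate_prime_of_fixed`). Hence each `h` acts as a combination of embeddings with
`σ`-fixed coefficients. Then `h · ω ^ j / ω ^ j` is a `σ`-fixed element of `L`, and so lies in `K`.

For the correspondence, the characters `Ψ ^ j` of `N` give a Fourier transform from `E[N]` to
functions on `ZMod p`, under which the `G`-fixed elements become the `K`-valued functions. The same
fixed point argument, for conjugation by `η` on another normalized regular subgroup, shows that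
subgroup to centralize `η`, hence to equal `⟨η⟩`. -/

/-- The algebra of functions `A → K` on a finite group `A`, with the comultiplication
`Δ(f)(a, b) = f (a + b)`; it is the dual of the group algebra. -/
def GroupFunctions (A : Type v) (K : Type u) : Type (max u v) := A → K

/-! ### The Hopf algebra of functions on a finite abelian group -/

namespace GroupFunctions

section Algebra

variable {A : Type v} {K : Type u} [Field K]

instance : CommRing (GroupFunctions A K) := inferInstanceAs (CommRing (A → K))

instance : Algebra K (GroupFunctions A K) := inferInstanceAs (Algebra K (A → K))

/-- Evaluation at a point. -/
def eval (a : A) : GroupFunctions A K →ₐ[K] K := Pi.evalAlgHom K (fun _ => K) a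

@[ext] theorem ext {f g : GroupFunctions A K} (h : ∀ a, eval a f = eval a g) : f = g := funext h

/-- Evaluation of an element of the tensor square at a pair. -/
noncomputable def evalPair (a b : A) : GroupFunctions A K ⊗[K] GroupFunctions A K →ₐ[K] K :=
  Algebra.TensorProduct.productMap (eval a) (eval b)

theorem evalPair_tmul (a b : A) (f g : GroupFunctions A K) :
    evalPair a b (f ⊗ₜ[K] g) = eval a f * eval b g := rfl

variable (A K) in
/-- The basis of indicator functions. -/
noncomputable def basis [Finite A] : Module.Basis A K (GroupFunctions A K) := Pi.basisFun K A

instance [Finite A] : Module.Finite K (GroupFunctions A K) :=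
  Module.Finite.of_basis (basis A K)

theorem basis_repr [Finite A] (f : GroupFunctions A K) (a : A) :
    (basis A K).repr f a = eval a f := rfl

/-- The values at pairs are the coordinates in the tensor product basis. Coalgebra identities
thereby become pointwise ones. -/
theorem tensor_ext [Finite A] {x y : GroupFunctions A K ⊗[K] GroupFunctions A K}
    (h : ∀ a b, evalPair a b x = evalPair a b y) : x = y := by
  apply ((basis A K).tensorProduct (basis A K)).ext_elem
  have key : ∀ (z : GroupFunctions A K ⊗[K] GroupFunctions A K) (a b : A),
      ((basis A K).tensorProduct (basis A K)).repr z (a, b) = evalPair a b z := by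
    intro z a b
    induction z with
    | zero => simp
    | tmul f g =>
      simp [evalPair_tmul, basis_repr, Module.Basis.tensorProduct_repr_tmul_apply, mul_comm]
    | add z w hz hw => simp [hz, hw]
  rintro ⟨a, b⟩
  rw [key, key, h]

theorem eval_basis [Finite A] [DecidableEq A] (a b : A) :
    eval a (basis A K b) = if a = b then 1 else 0 := by
  rw [← basis_repr, Module.Basis.repr_self, Finsupp.single_apply]
  simp only [eq_comm]

end Algebra

variable {A : Type v} {K : Type u} [Field K] [AddCommGroup A] [Fintype A]

/-- The indicator of `c`, pulled back along addition, is the sum of the indicators of the pairs `(a,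
c - a)`. -/
noncomputable instance : CoalgebraStruct K (GroupFunctions A K) where
  comul := (basis A K).constr K fun c => ∑ a, basis A K a ⊗ₜ[K] basis A K (c - a)
  counit := (eval 0).toLinearMap

theorem comul_basis (c : A) : Coalgebra.comul (R := K) (basis A K c) =
    ∑ a, basis A K a ⊗ₜ[K] basis A K (c - a) :=
  (basis A K).constr_basis K _ c

theorem counit_eq (f : GroupFunctions A K) : Coalgebra.counit (R := K) f = eval 0 f := rfl

noncomputable instance : Coalgebra K (GroupFunctions A K) where
  coassoc := by
    refine (basis A K).ext fun c => ?_
    simp only [LinearMap.comp_apply, comul_basis, map_sum, LinearMap.rTensor_tmul,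
      LinearMap.lTensor_tmul, TensorProduct.sum_tmul, TensorProduct.tmul_sum,
      LinearEquiv.coe_coe, TensorProduct.assoc_tmul]
    rw [Finset.sum_comm]
    refine Finset.sum_congr rfl fun a _ => ?_
    refine Fintype.sum_equiv (Equiv.subRight a) _ _ fun b => ?_
    simp
  rTensor_counit_comp_comul := by
    classical
    refine (basis A K).ext fun c => ?_
    simp [comul_basis, map_sum, counit_eq, eval_basis, TensorProduct.ite_tmul]
  lTensor_counit_comp_comul := by
    classical
    refine (basis A K).ext fun c => ?_
    simp only [LinearMap.comp_apply, comul_basis, map_sum, LinearMap.lTensor_tmul, counit_eq,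
      eval_basis]
    simp [sub_eq_zero, TensorProduct.tmul_ite, eq_comm (a := (0 : A))]

theorem evalPair_comul (a b : A) (f : GroupFunctions A K) :
    evalPair a b (Coalgebra.comul (R := K) f) = eval (a + b) f := by
  classical
  suffices h : (evalPair a b).toLinearMap ∘ₗ Coalgebra.comul = (eval (a + b)).toLinearMap from
    LinearMap.congr_fun h f
  refine (basis A K).ext fun c => ?_
  simp only [LinearMap.comp_apply, AlgHom.toLinearMap_apply, comul_basis, map_sum, evalPair_tmul,
    eval_basis, eq_sub_iff_add_eq']
  rw [Finset.sum_eq_single a (fun d _ hd => by simp [hd.symm]) (by simp)]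
  simp

noncomputable instance : Bialgebra K (GroupFunctions A K) :=
  Bialgebra.mk' K _ (map_one (eval 0)) (map_mul (eval 0) _ _)
    (tensor_ext fun a b => by simp [evalPair_comul])
    (tensor_ext fun a b => by simp [evalPair_comul])

/-- Precomposition with negation. -/
def antipodeMap : GroupFunctions A K →ₗ[K] GroupFunctions A K := LinearMap.funLeft K K Neg.neg

omit [Fintype A] in
theorem eval_antipodeMap (a : A) (f : GroupFunctions A K) :
    eval a (antipodeMap f) = eval (-a) f := rfl

noncomputable instance : HopfAlgebra K (GroupFunctions A K) where
  antipode := antipodeMap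
  mul_antipode_rTensor_comul := by
    have key (z : GroupFunctions A K ⊗[K] GroupFunctions A K) (a : A) :
        eval a (LinearMap.mul' K _ (antipodeMap.rTensor _ z)) = evalPair (-a) a z := by
      induction z with
      | zero => simp
      | tmul f g => simp [evalPair_tmul, eval_antipodeMap]
      | add z w hz hw => simp [hz, hw]
    ext f a
    simp [key, evalPair_comul, counit_eq]
  mul_antipode_lTensor_comul := by
    have key (z : GroupFunctions A K ⊗[K] GroupFunctions A K) (a : A) :
        eval a (LinearMap.mul' K _ (antipodeMap.lTensor _ z)) = evalPair a (-a) z := by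
      induction z with
      | zero => simp
      | tmul f g => simp [evalPair_tmul, eval_antipodeMap]
      | add z w hz hw => simp [hz, hw]
    ext f a
    simp [key, evalPair_comul, counit_eq]

instance : Coalgebra.IsCocomm K (GroupFunctions A K) where
  comm_comp_comul := by
    refine (basis A K).ext fun c => ?_
    simp only [LinearMap.comp_apply, comul_basis, map_sum, LinearEquiv.coe_coe,
      TensorProduct.comm_tmul]
    refine Fintype.sum_equiv (Equiv.subLeft c) _ _ fun b => ?_
    simp

end GroupFunctions

/-! ### Diagonal actions on a basis -/

section Graded

variable {A K : Type*} {L : Type v} [Field K] [Field L] [Algebra K L]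

/-- The diagonal action of functions on a basis. -/
noncomputable def diagonalAct [Finite A] (B : Module.Basis A K L) :
    GroupFunctions A K →ₐ[K] Module.End K L :=
  AlgHom.ofLinearMap
    { toFun := fun f => B.constr K fun a => GroupFunctions.eval a f • B a
      map_add' := fun f g => B.ext fun a => by simp [add_smul]
      map_smul' := fun k f => B.ext fun a => by simp [mul_smul] }
    (B.ext fun a => by simp)
    (fun f g => B.ext fun a => by simp [smul_smul, mul_comm])

theorem diagonalAct_basis [Finite A] (B : Module.Basis A K L) (f : GroupFunctions A K) (a : A) :
    diagonalAct B f (B a) = GroupFunctions.eval a f • B a := by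
  simp [diagonalAct]

/-- Bilinearity in `s` and `t` allows the module algebra axiom to be checked on basis vectors only.
-/
theorem exists_bilinear_eq_mul'_map {H : Type*} [AddCommGroup H] [Module K H]
    (α : H →ₗ[K] Module.End K L) (z : H ⊗[K] H) : ∃ β : L →ₗ[K] L →ₗ[K] L, ∀ s t, β s t =
      LinearMap.mul' K L
        (TensorProduct.map (LinearMap.applyₗ s ∘ₗ α) (LinearMap.applyₗ t ∘ₗ α) z) := by
  induction z with
  | zero => exact ⟨0, by simp⟩
  | tmul g h => exact ⟨(LinearMap.mul K L).compl₁₂ (α g) (α h), by simp⟩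
  | add z w hz hw =>
    obtain ⟨β, hβ⟩ := hz
    obtain ⟨γ, hγ⟩ := hw
    exact ⟨β + γ, by simp [hβ, hγ]⟩

end Graded

/-! ### Hopf–Galois structures that are diagonal for a grading -/

section HopfGalois

variable {A : Type*} [AddCommGroup A] [Fintype A]

/-- The Hopf-Galois structure of an extension graded by `A` with one-dimensional components, for
the dual of the group algebra of `A`. -/
noncomputable def gradedHopfGaloisStructure {K : Type u} {L : Type v} [Field K] [Field L]
    [Algebra K L] (B : Module.Basis A K L) (c : A → A → K) (h0 : B 0 = 1)
    (hc : ∀ a b, B a * B b = c a b • B (a + b)) : HopfGaloisStructure K L where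
  H := GroupFunctions A K
  act := diagonalAct B
  act_one f := by
    rw [← h0, diagonalAct_basis, h0, Algebra.smul_def, mul_one]
    rfl
  act_mul f s t := by
    have key (a b : A) (z : GroupFunctions A K ⊗[K] GroupFunctions A K) :
        LinearMap.mul' K L (TensorProduct.map
          (LinearMap.applyₗ (B a) ∘ₗ (diagonalAct B).toLinearMap)
          (LinearMap.applyₗ (B b) ∘ₗ (diagonalAct B).toLinearMap) z) =
        GroupFunctions.evalPair a b z • (B a * B b) := by
      induction z with
      | zero => simp
      | tmul f g =>
        simp [GroupFunctions.evalPair_tmul, diagonalAct_basis, smul_smul, mul_comm]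
      | add z w hz hw => simp [hz, hw, add_smul]
    obtain ⟨β, hβ⟩ := exists_bilinear_eq_mul'_map (diagonalAct B).toLinearMap
      (Coalgebra.comul (R := K) f)
    suffices h : (LinearMap.mul K L).compr₂ (diagonalAct B f) = β by
      rw [← hβ, ← h]
      rfl
    refine B.ext fun a => B.ext fun b => ?_
    rw [hβ, key, GroupFunctions.evalPair_comul, LinearMap.compr₂_apply, LinearMap.mul_apply', hc,
      map_smul, diagonalAct_basis, smul_smul, smul_smul, mul_comm]
  galois := by
    classical
    have hL : Module.Finite K L := Module.Finite.of_basis B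
    have hsurj : Function.Surjective (LinearMap.mul' K (Module.End K L) ∘ₗ
        TensorProduct.map (Algebra.lmul K L).toLinearMap (diagonalAct B).toLinearMap) := by
      intro f
      -- The indicator of `a` projects onto the line of `B a`; multiplying by `f (B a) / B a` then
      -- moves `B a` to `f (B a)`.
      refine ⟨∑ a, (f (B a) * (B a)⁻¹) ⊗ₜ[K] GroupFunctions.basis A K a, B.ext fun b => ?_⟩
      simp only [map_sum, LinearMap.comp_apply, TensorProduct.map_tmul, LinearMap.mul'_apply,
        LinearMap.sum_apply, AlgHom.toLinearMap_apply, Module.End.mul_apply, diagonalAct_basis,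
        GroupFunctions.eval_basis]
      simp [B.ne_zero b]
    refine ⟨(LinearMap.injective_iff_surjective_of_finrank_eq_finrank ?_).mpr hsurj, hsurj⟩
    rw [Module.finrank_tensorProduct, Module.finrank_linearMap,
      Module.finrank_eq_card_basis B, Module.finrank_eq_card_basis (GroupFunctions.basis A K)]

namespace HopfGaloisStructure

variable {K : Type u} {L : Type v} [Field K] [Field L] [Algebra K L]

theorem act_injective (T : HopfGaloisStructure.{u, v, w} K L) : Function.Injective T.act := by
  intro g h hgh
  have h1 : (1 : L) ⊗ₜ[K] g = 1 ⊗ₜ[K] h := T.galois.1 (by simp [hgh])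
  exact Algebra.TensorProduct.includeRight_injective (algebraMap K L).injective h1

/-- The Galois bijection gives `dim L * dim H = (dim L) ^ 2`. -/
theorem finite_and_finrank_eq [Module.Finite K L] (T : HopfGaloisStructure.{u, v, w} K L) :
    Module.Finite K T.H ∧ Module.finrank K T.H = Module.finrank K L := by
  have hf : Module.Finite K T.H :=
    Module.Finite.of_injective T.act.toLinearMap T.act_injective
  refine ⟨hf, ?_⟩
  have h := (LinearEquiv.ofBijective _ T.galois).finrank_eq
  rw [Module.finrank_tensorProduct, Module.finrank_linearMap] at h
  exact Nat.eq_of_mul_eq_mul_left Module.finrank_pos h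

/-- The scalars by which a Hopf algebra acts on a basis of eigenvectors, as a function. -/
noncomputable def diagonalFunction (T : HopfGaloisStructure.{u, v, w} K L)
    (B : Module.Basis A K L) : T.H →ₗ[K] GroupFunctions A K where
  toFun h := fun a => B.repr (T.act h (B a)) a
  map_add' g h := funext fun a => by simp; rfl
  map_smul' k h := funext fun a => by simp; rfl

omit [AddCommGroup A] [Fintype A] in
theorem act_basis_eq (T : HopfGaloisStructure.{u, v, w} K L) (B : Module.Basis A K L)
    (hT : ∀ h a, ∃ k : K, T.act h (B a) = k • B a) (h : T.H) (a : A) :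
    T.act h (B a) = GroupFunctions.eval a (T.diagonalFunction B h) • B a := by
  obtain ⟨k, hk⟩ := hT h a
  change _ = B.repr (T.act h (B a)) a • B a
  simp [hk]

/-- The map is `h ↦ (eigenvalue of h on B a)`. It is injective since the action is faithful, hence
bijective by dimension. The axioms `act_one` at `B 0 = 1` and `act_mul` on `B a * B b` say that it
respects counit and comultiplication. -/
theorem exists_bialgEquiv_of_diagonal (T : HopfGaloisStructure.{u, v, w} K L)
    (B : Module.Basis A K L) (c : A → A → K) (h0 : B 0 = 1)
    (hc : ∀ a b, B a * B b = c a b • B (a + b))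
    (hT : ∀ h a, ∃ k : K, T.act h (B a) = k • B a) :
    ∃ e : T.H ≃ₐc[K] GroupFunctions A K,
      ∀ h a, T.act h (B a) = GroupFunctions.eval a (e h) • B a := by
  have hL : Module.Finite K L := Module.Finite.of_basis B
  have hact := T.act_basis_eq B hT
  have hcancel {a : A} {x y : K} (hxy : x • B a = y • B a) : x = y :=
    smul_left_injective K (B.ne_zero a) hxy
  let χ : T.H →ₐ[K] GroupFunctions A K := AlgHom.ofLinearMap (T.diagonalFunction B)
    (GroupFunctions.ext fun a => hcancel (by rw [← hact]; simp))
    (fun g h => GroupFunctions.ext fun a => hcancel (by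
      rw [← hact, map_mul, map_mul, Module.End.mul_apply, hact h, map_smul, hact g, smul_smul,
        mul_comm]))
  have hχ (h : T.H) (a : A) : T.act h (B a) = GroupFunctions.eval a (χ h) • B a := hact h a
  have hinj : Function.Injective χ := by
    intro g h hgh
    refine T.act_injective (B.ext fun a => ?_)
    rw [hχ, hχ, hgh]
  obtain ⟨hf, hrank⟩ := T.finite_and_finrank_eq
  have hbij : Function.Bijective χ := by
    refine ⟨hinj, (LinearMap.injective_iff_surjective_of_finrank_eq_finrank
      (f := χ.toLinearMap) ?_).mp hinj⟩
    rw [hrank, Module.finrank_eq_card_basis B,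
      Module.finrank_eq_card_basis (GroupFunctions.basis A K)]
  have hcounit (h : T.H) : Coalgebra.counit (R := K) (χ h) = Coalgebra.counit (R := K) h := by
    refine hcancel (a := 0) ?_
    rw [GroupFunctions.counit_eq, ← hχ, h0, T.act_one, Algebra.smul_def, mul_one]
  have hcomul (h : T.H) : TensorProduct.map χ.toLinearMap χ.toLinearMap
      (Coalgebra.comul (R := K) h) = Coalgebra.comul (R := K) (χ h) := by
    refine GroupFunctions.tensor_ext fun a b => hcancel (a := a + b) ?_
    have key (z : T.H ⊗[K] T.H) :
        LinearMap.mul' K L (TensorProduct.map (LinearMap.applyₗ (B a) ∘ₗ T.act.toLinearMap)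
          (LinearMap.applyₗ (B b) ∘ₗ T.act.toLinearMap) z) =
        GroupFunctions.evalPair a b (TensorProduct.map χ.toLinearMap χ.toLinearMap z) •
          (B a * B b) := by
      induction z with
      | zero => simp
      | tmul f g =>
        simp [GroupFunctions.evalPair_tmul, hχ, smul_smul, mul_comm]
      | add z w hz hw => simp [hz, hw, add_smul]
    have h1 := T.act_mul h (B a) (B b)
    rw [key, hc, map_smul, hχ, smul_smul, smul_smul] at h1
    -- `L` is a field, so `B a * B b` is nonzero and the structure constant can be cancelled.
    have hcab : c a b ≠ 0 := by
      intro h2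
      have := hc a b
      rw [h2, zero_smul] at this
      exact mul_ne_zero (B.ne_zero a) (B.ne_zero b) this
    rw [GroupFunctions.evalPair_comul]
    have h3 := hcancel h1
    rw [mul_comm] at h3
    rw [mul_right_cancel₀ hcab h3]
  exact ⟨BialgEquiv.ofAlgEquiv (AlgEquiv.ofBijective χ hbij) (AlgHom.ext hcounit)
    (AlgHom.ext hcomul), hχ⟩

theorem equivalent_of_diagonal (T : HopfGaloisStructure.{u, v, w} K L)
    (B : Module.Basis A K L) (c : A → A → K) (h0 : B 0 = 1)
    (hc : ∀ a b, B a * B b = c a b • B (a + b))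
    (hT : ∀ h a, ∃ k : K, T.act h (B a) = k • B a) :
    (gradedHopfGaloisStructure B c h0 hc).Equivalent T := by
  obtain ⟨e, he⟩ := T.exists_bialgEquiv_of_diagonal B c h0 hc hT
  have h (f : GroupFunctions A K) : T.act (e.symm f) = diagonalAct B f :=
    B.ext fun a => by rw [he, diagonalAct_basis, BialgEquiv.apply_symm_apply]
  exact ⟨e.symm, fun f t => LinearMap.congr_fun (h f) t⟩

end HopfGaloisStructure

end HopfGalois

/-- The number of fixed points is congruent to `p` modulo `p` and is positive, so it is `p`. -/
theorem eq_of_iterate_prime_of_fixed {α : Type*} [Finite α] {p : ℕ} [Fact p.Prime]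
    (hcard : Nat.card α = p) {f : α → α} (hf : f^[p] = id) {x : α} (hx : f x = x) (y : α) :
    f y = y := by
  classical
  have := Fintype.ofFinite α
  have hmod := Equiv.Perm.card_fixedPoints_modEq (f := (f : Function.End α)) (p := p) (n := 1)
    (by rw [pow_one]; exact hf)
  have hp : Fintype.card α = p := by rw [← hcard, Nat.card_eq_fintype_card]
  rw [hp] at hmod
  have hpos : 0 < Fintype.card (Function.fixedPoints f) := Fintype.card_pos_iff.mpr ⟨⟨x, hx⟩⟩
  have hdvd : p ∣ Fintype.card (Function.fixedPoints f) :=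
    (Nat.modEq_zero_iff_dvd).mp (hmod.symm.trans (by simp [Nat.ModEq]))
  have hle := Nat.le_of_dvd hpos hdvd
  have huniv : Function.fixedPoints f = Set.univ := by
    rw [← Set.toFinset_inj, Set.toFinset_univ, ← Finset.card_eq_iff_eq_univ, Set.toFinset_card]
    exact le_antisymm (set_fintype_card_le_univ _) (hp ▸ hle)
  exact (Set.eq_univ_iff_forall.mp huniv y : f y = y)

/-! ### Multiplicativity as equations in coordinates -/

section Coordinates

variable {K L E ι : Type*} [Field K] [Field L] [Field E] [Algebra K L] [Algebra K E] [Fintype ι]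

/-- The functions `θ l s * θ m t` of two variables are independent over `E`, so coefficients may be
compared. When the `γ` come from `K`, the resulting equations are preserved by every
`K`-automorphism of `E`. -/
theorem sum_smul_apply_mul_iff {θ : ι → L →ₗ[K] E} (hli : LinearIndependent E θ)
    {γ : ι → ι → ι → E}
    (hγ : ∀ k s t, θ k (s * t) = ∑ l, ∑ m, γ k l m * (θ l s * θ m t)) (c : ι → E) :
    (∀ s t, (∑ k, c k • θ k) (s * t) = (∑ k, c k • θ k) s * (∑ k, c k • θ k) t) ↔
      ∀ l m, c l * c m = ∑ k, c k * γ k l m := by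
  have h1 (s t : L) : (∑ k, c k • θ k) (s * t) =
      ∑ l, ∑ m, (∑ k, c k * γ k l m) * (θ l s * θ m t) := by
    simp only [LinearMap.sum_apply, LinearMap.smul_apply, hγ, smul_eq_mul, Finset.mul_sum,
      Finset.sum_mul]
    rw [Finset.sum_comm]
    refine Finset.sum_congr rfl fun l _ => ?_
    rw [Finset.sum_comm]
    simp only [mul_assoc]
  have h2 (s t : L) : (∑ k, c k • θ k) s * (∑ k, c k • θ k) t =
      ∑ l, ∑ m, (c l * c m) * (θ l s * θ m t) := by
    simp only [LinearMap.sum_apply, LinearMap.smul_apply, smul_eq_mul, Finset.sum_mul_sum]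
    refine Finset.sum_congr rfl fun l _ => Finset.sum_congr rfl fun m _ => ?_
    ring
  have hli' := Fintype.linearIndependent_iff.mp hli
  refine ⟨fun h l m => ?_, fun h s t => by simp only [h1, h2, h]⟩
  rw [← sub_eq_zero]
  refine hli' (fun m => c l * c m - ∑ k, c k * γ k l m) (LinearMap.ext fun t => ?_) m
  -- Independence is used once in `s` with `t` frozen, then once in `t`.
  have h3 := hli' (fun l => ∑ m, (c l * c m - ∑ k, c k * γ k l m) * θ m t)
    (LinearMap.ext fun s => ?_) l
  · simpa using h3
  · have h4 := h s t
    rw [h1, h2, eq_comm, ← sub_eq_zero, ← Finset.sum_sub_distrib] at h4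
    simp only [LinearMap.sum_apply, LinearMap.smul_apply, smul_eq_mul, LinearMap.zero_apply]
    rw [← h4]
    refine Finset.sum_congr rfl fun l _ => ?_
    rw [← Finset.sum_sub_distrib, Finset.sum_mul]
    refine Finset.sum_congr rfl fun m _ => ?_
    ring

end Coordinates

/-! ### Semilinear descent for an arbitrary Hopf–Galois structure -/

namespace HopfGaloisStructure

variable {K : Type u} {L : Type v} {E : Type x} [Field K] [Field L] [Field E]
  [Algebra K L] [Algebra K E] [Algebra L E] [IsScalarTower K L E]

variable (E) in
/-- The action of an element of the Hopf algebra, followed by the inclusion `L → E`. -/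
noncomputable def actInto (T : HopfGaloisStructure.{u, v, w} K L) : T.H →ₗ[K] L →ₗ[K] E :=
  (LinearMap.compRight K (IsScalarTower.toAlgHom K L E).toLinearMap) ∘ₗ T.act.toLinearMap

theorem actInto_apply (T : HopfGaloisStructure.{u, v, w} K L) (h : T.H) (y : L) :
    T.actInto E h y = algebraMap L E (T.act h y) := rfl

/-- Coordinate forms of a `K`-basis of `L` span all maps `L → E` over `E`, and each of them, as an
endomorphism of `L`, is in the image of `L ⊗ H` by surjectivity of the Galois map. -/
theorem span_actInto [Module.Finite K L] (T : HopfGaloisStructure.{u, v, w} K L)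
    {ι : Type*} [Finite ι]
    (b : Module.Basis ι K T.H) :
    ⊤ ≤ Submodule.span E (Set.range fun i => T.actInto E (b i)) := by
  have h1 (h : T.H) : T.actInto E h ∈ Submodule.span E (Set.range fun i => T.actInto E (b i)) := by
    have := Fintype.ofFinite ι
    rw [← b.sum_repr h, map_sum]
    refine Submodule.sum_mem _ fun i _ => ?_
    rw [map_smul, ← algebraMap_smul E]
    exact Submodule.smul_mem _ _ (Submodule.subset_span ⟨i, rfl⟩)
  have h2 (z : L ⊗[K] T.H) : (IsScalarTower.toAlgHom K L E).toLinearMap ∘ₗ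
      ((LinearMap.mul' K (Module.End K L) ∘ₗ
        TensorProduct.map (Algebra.lmul K L).toLinearMap T.act.toLinearMap) z) ∈
      Submodule.span E (Set.range fun i => T.actInto E (b i)) := by
    induction z with
    | zero => simp
    | tmul s h =>
      convert Submodule.smul_mem _ (algebraMap L E s) (h1 h)
      ext y
      simp [actInto_apply, Algebra.smul_def]
    | add z w hz hw =>
      rw [map_add, LinearMap.comp_add]
      exact add_mem hz hw
  intro f _
  let B := Module.finBasis K L
  have hf : f = ∑ a, f (B a) • ((IsScalarTower.toAlgHom K L E).toLinearMap ∘ₗ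
      (Algebra.linearMap K L ∘ₗ B.coord a)) := by
    refine B.ext fun a' => ?_
    simp [Finsupp.single_apply]
  rw [hf]
  refine Submodule.sum_mem _ fun a _ => Submodule.smul_mem _ _ ?_
  obtain ⟨z, hz⟩ := T.galois.2 (Algebra.linearMap K L ∘ₗ B.coord a)
  rw [← hz]
  exact h2 z

theorem exists_fixed_coeff [Module.Finite K L] (T : HopfGaloisStructure.{u, v, w} K L) {p : ℕ}
    [Fact p.Prime] {σ : E ≃ₐ[K] E} (hσ : σ ^ p = 1) [Fintype (L →ₐ[K] E)]
    (hcard : Nat.card (L →ₐ[K] E) = p) (hrank : Module.finrank K L = p) (h : T.H) :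
    ∃ d : (L →ₐ[K] E) → E, (∀ f, σ (d f) = d f) ∧
      ∀ y, algebraMap L E (T.act h y) = ∑ f, d f * f y := by
  obtain ⟨hf, hrankH⟩ := T.finite_and_finrank_eq
  let b := Module.finBasis K T.H
  let θ := fun i => T.actInto E (b i)
  let C := basisOfTopLeSpanOfCardEqFinrank θ (T.span_actInto b) (by
    rw [Module.finrank_linearMap_self, Fintype.card_fin, hrankH])
  have hC : ⇑C = θ := coe_basisOfTopLeSpanOfCardEqFinrank _ _ _
  have hli : LinearIndependent E θ := hC ▸ C.linearIndependent
  have : Nonempty (L →ₐ[K] E) := ⟨IsScalarTower.toAlgHom K L E⟩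
  -- Dedekind independence: the `p` embeddings form the second `E`-basis.
  let D := basisOfLinearIndependentOfCardEqFinrank (linearIndependent_toLinearMap K L E) (by
    rw [Module.finrank_linearMap_self, ← Nat.card_eq_fintype_card, hcard, hrank])
  have hD (f : L →ₐ[K] E) : D f = f.toLinearMap := by
    simp [D]
  let γ : _ → _ → _ → K := fun k l m =>
    (b.tensorProduct b).repr (Coalgebra.comul (R := K) (b k)) (l, m)
  have hγ (k s t) : θ k (s * t) = ∑ l, ∑ m, algebraMap K E (γ k l m) * (θ l s * θ m t) := by
    have h1 := T.act_mul (b k) s t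
    rw [← (b.tensorProduct b).sum_repr (Coalgebra.comul (R := K) (b k)),
      Fintype.sum_prod_type] at h1
    simp only [map_sum, map_smul, Module.Basis.tensorProduct_apply, TensorProduct.map_tmul,
      LinearMap.mul'_apply] at h1
    simp only [θ, actInto_apply]
    rw [h1]
    simp only [map_sum, Algebra.smul_def, map_mul, ← IsScalarTower.algebraMap_apply]
    rfl
  -- `τ` is the `σ`-semilinear map that fixes the action of every element of `H`; it corresponds to
  -- `σ ⊗ 1` on `E ⊗ H`.
  let τ : (L →ₗ[K] E) → (L →ₗ[K] E) := fun v => ∑ i, σ (C.repr v i) • θ i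
  have hτrepr (v i) : C.repr (τ v) i = σ (C.repr v i) := by
    simp only [τ, ← hC, C.repr_sum_self]
  have hτsum (d : (L →ₐ[K] E) → E) : τ (∑ f, d f • D f) = ∑ f, σ (d f) • τ (D f) := by
    refine C.ext_elem fun i => ?_
    simp [hτrepr, Finsupp.finsetSum_apply]
  have hCact (h : T.H) (i) : C.repr (T.actInto E h) i = algebraMap K E (b.repr h i) := by
    have h1 : T.actInto E h = ∑ i, algebraMap K E (b.repr h i) • C i := by
      conv_lhs => rw [← b.sum_repr h]
      rw [map_sum, hC]
      exact Finset.sum_congr rfl fun i _ => by rw [map_smul, algebraMap_smul]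
    rw [h1, C.repr_sum_self]
  have hτact (h : T.H) : τ (T.actInto E h) = T.actInto E h :=
    C.ext_elem fun i => by rw [hτrepr, hCact, AlgEquiv.commutes]
  -- Counit and comultiplication have coefficients in `K`, so `σ` preserves the equations that
  -- characterize algebra maps.
  have hτalg (f : L →ₐ[K] E) : ∃ g : L →ₐ[K] E, g.toLinearMap = τ f.toLinearMap := by
    have hf1 : f.toLinearMap = ∑ i, C.repr f.toLinearMap i • θ i := by
      rw [← hC, C.sum_repr]
    have hθ1 (i) : θ i 1 = algebraMap K E (Coalgebra.counit (R := K) (b i)) := by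
      rw [IsScalarTower.algebraMap_apply K L E, ← T.act_one]
      rfl
    refine ⟨AlgHom.ofLinearMap (τ f.toLinearMap) ?_ ?_, rfl⟩
    · have h1 := congrArg σ (LinearMap.congr_fun hf1 1)
      simp only [LinearMap.sum_apply, LinearMap.smul_apply, hθ1, smul_eq_mul, map_sum, map_mul,
        AlgEquiv.commutes, AlgHom.toLinearMap_apply, map_one] at h1
      simp only [τ, LinearMap.sum_apply, LinearMap.smul_apply, hθ1, smul_eq_mul]
      exact h1.symm
    · refine (sum_smul_apply_mul_iff hli hγ _).mpr fun l m => ?_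
      have h1 := (sum_smul_apply_mul_iff hli hγ (fun i => C.repr f.toLinearMap i)).mp
        (by rw [← hf1]; exact map_mul f) l m
      have h2 := congrArg σ h1
      simpa only [map_sum, map_mul, AlgEquiv.commutes] using h2
  choose S hS using hτalg
  have hSp : S^[p] = id := by
    have h1 (n : ℕ) (f : L →ₐ[K] E) (i) : C.repr (S^[n] f).toLinearMap i =
        (σ ^ n) (C.repr f.toLinearMap i) := by
      induction n with
      | zero => simp
      | succ n ih =>
        rw [Function.iterate_succ_apply', hS, hτrepr, ih, pow_succ', AlgEquiv.mul_apply]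
    funext f
    refine AlgHom.toLinearMap_injective (C.ext_elem fun i => ?_)
    rw [h1, hσ, id, AlgEquiv.one_apply]
  -- The inclusion is the action of `1 ∈ H`, which supplies the fixed point.
  have hS1 : S (IsScalarTower.toAlgHom K L E) = IsScalarTower.toAlgHom K L E := by
    apply AlgHom.toLinearMap_injective
    have h1 : (IsScalarTower.toAlgHom K L E).toLinearMap = T.actInto E 1 := by
      ext y
      simp [actInto_apply]
    rw [hS, h1, hτact]
  have hSall := eq_of_iterate_prime_of_fixed hcard hSp hS1
  refine ⟨fun f => D.repr (T.actInto E h) f, fun f => ?_, fun y => ?_⟩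
  · have h1 := hτact h
    rw [← D.sum_repr (T.actInto E h), hτsum] at h1
    simp only [hD, ← hS, hSall] at h1
    simp only [← hD] at h1
    have h2 := congrArg (fun v => D.repr v f) h1
    simpa only [D.repr_sum_self] using h2
  · rw [← actInto_apply]
    conv_lhs => rw [← D.sum_repr (T.actInto E h)]
    simp [hD]

end HopfGaloisStructure

/-! ### The radical extension and its basis of powers -/

section Radical

open Polynomial

theorem algHom_ext_of_adjoin_eq_top {K M F : Type*} [Field K] [Field M] [Field F] [Algebra K M]
    [Algebra K F] [Algebra.IsAlgebraic K M] {s : Set M} (hs : IntermediateField.adjoin K s = ⊤)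
    {f g : M →ₐ[K] F} (h : Set.EqOn f g s) : f = g :=
  AlgHom.ext_of_adjoin_eq_top (IntermediateField.adjoin_eq_top_iff.mp hs) h

variable {p : ℕ} [Fact p.Prime] {K : Type u} {L : Type v} [Field K] [Field L] [Algebra K L]
  {ω : L} {a : K}

theorem ne_zero_of_forall_pow_ne (ha : ∀ b : K, b ^ p ≠ a) : a ≠ 0 := by
  rintro rfl
  exact ha 0 (zero_pow (Fact.out : p.Prime).ne_zero)

theorem radical_ne_zero (hω : ω ^ p = algebraMap K L a) (ha : ∀ b : K, b ^ p ≠ a) : ω ≠ 0 := by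
  rintro rfl
  rw [zero_pow (Fact.out : p.Prime).ne_zero, eq_comm, map_eq_zero] at hω
  exact ne_zero_of_forall_pow_ne ha hω

theorem minpoly_radical (hω : ω ^ p = algebraMap K L a) (ha : ∀ b : K, b ^ p ≠ a) :
    minpoly K ω = X ^ p - C a :=
  (minpoly.eq_of_irreducible_of_monic (X_pow_sub_C_irreducible_of_prime Fact.out ha)
    (by simp [hω]) (monic_X_pow_sub_C a (Fact.out : p.Prime).ne_zero)).symm

theorem isIntegral_radical (hω : ω ^ p = algebraMap K L a) : IsIntegral K ω :=
  ⟨X ^ p - C a, monic_X_pow_sub_C a (Fact.out : p.Prime).ne_zero, by simp [hω]⟩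

theorem finrank_radical (hω : ω ^ p = algebraMap K L a) (ha : ∀ b : K, b ^ p ≠ a)
    (hL : IntermediateField.adjoin K {ω} = ⊤) : Module.finrank K L = p := by
  rw [← IntermediateField.finrank_top', ← hL,
    IntermediateField.adjoin.finrank (isIntegral_radical hω), minpoly_radical hω ha,
    natDegree_X_pow_sub_C]

theorem finite_radical (hω : ω ^ p = algebraMap K L a) (ha : ∀ b : K, b ^ p ≠ a)
    (hL : IntermediateField.adjoin K {ω} = ⊤) : Module.Finite K L :=
  Module.finite_of_finrank_pos (by
    rw [finrank_radical hω ha hL]; exact (Fact.out : p.Prime).pos)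

theorem exists_radical_basis (hω : ω ^ p = algebraMap K L a) (ha : ∀ b : K, b ^ p ≠ a)
    (hL : IntermediateField.adjoin K {ω} = ⊤) :
    ∃ B : Module.Basis (ZMod p) K L, ∀ j, B j = ω ^ j.val := by
  have h1 : LinearIndependent K fun j : ZMod p => ω ^ j.val := by
    refine (linearIndependent_pow (K := K) ω).comp
      (fun j : ZMod p => ⟨j.val, ?_⟩) ?_
    · rw [minpoly_radical hω ha, natDegree_X_pow_sub_C]
      exact j.val_lt
    · intro i j hij
      exact ZMod.val_injective p (Fin.mk.inj_iff.mp hij)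
  exact ⟨basisOfLinearIndependentOfCardEqFinrank h1
    (by rw [ZMod.card, finrank_radical hω ha hL]), fun j => by simp⟩

/-- The exponent of `a` is the carry in adding the representatives of `i` and `j`. -/
theorem radical_pow_mul_pow (hω : ω ^ p = algebraMap K L a) (i j : ZMod p) :
    ω ^ i.val * ω ^ j.val = a ^ ((i.val + j.val) / p) • ω ^ (i + j).val := by
  rw [ZMod.val_add, Algebra.smul_def, map_pow, ← hω, ← pow_mul, ← pow_add, ← pow_add,
    Nat.div_add_mod]

end Radical

/-! ### The Galois closure and diagonality of every action -/

section Closure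

open Polynomial

variable {p : ℕ} [Fact p.Prime] {K : Type u} {L : Type v} {E : Type x} [Field K] [Field L]
  [Field E] [Algebra K L] [Algebra K E] [Algebra L E] [IsScalarTower K L E]
  {ω : L} {a : K} {ζ : E}

omit [Fact p.Prime] in
theorem algebraMap_radical_pow (hω : ω ^ p = algebraMap K L a) :
    algebraMap L E ω ^ p = algebraMap K E a := by
  rw [← map_pow, hω, ← IsScalarTower.algebraMap_apply]

/-- The roots `ω` and `ζ * ω` generate `E`, since their quotient is `ζ`. -/
theorem isSplittingField_radical (hω : ω ^ p = algebraMap K L a) (ha : ∀ b : K, b ^ p ≠ a)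
    (hζ : IsPrimitiveRoot ζ p) (hE : IntermediateField.adjoin K {algebraMap L E ω, ζ} = ⊤) :
    (X ^ p - C a).IsSplittingField K E := by
  have hω' := algebraMap_radical_pow (E := E) hω
  have hω0 : algebraMap L E ω ≠ 0 := by simpa using radical_ne_zero hω ha
  have hne : (X ^ p - C a) ≠ 0 := (monic_X_pow_sub_C a (Fact.out : p.Prime).ne_zero).ne_zero
  rw [isSplittingField_iff_intermediateField]
  refine ⟨?_, ?_⟩
  · rw [Polynomial.map_sub, Polynomial.map_pow, map_X, map_C]
    exact X_pow_sub_C_splits_of_isPrimitiveRoot hζ hω'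
  · have h1 : algebraMap L E ω ∈ IntermediateField.adjoin K ((X ^ p - C a).rootSet E) :=
      IntermediateField.subset_adjoin _ _ (by simp [mem_rootSet, hne, hω'])
    have h2 : ζ * algebraMap L E ω ∈ IntermediateField.adjoin K ((X ^ p - C a).rootSet E) :=
      IntermediateField.subset_adjoin _ _ (by
        simp [mem_rootSet, hne, hω', mul_pow, hζ.pow_eq_one])
    rw [eq_top_iff, ← hE, IntermediateField.adjoin_le_iff]
    rintro y (rfl | rfl)
    · exact h1
    · simpa [hω0] using div_mem h2 h1

theorem isGalois_radical [CharZero K] (hω : ω ^ p = algebraMap K L a) (ha : ∀ b : K, b ^ p ≠ a)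
    (hζ : IsPrimitiveRoot ζ p) (hE : IntermediateField.adjoin K {algebraMap L E ω, ζ} = ⊤) :
    FiniteDimensional K E ∧ IsGalois K E := by
  have h1 := isSplittingField_radical hω ha hζ hE
  refine ⟨IsSplittingField.finiteDimensional E (X ^ p - C a),
    IsGalois.of_separable_splitting_field (p := X ^ p - C a)
    (separable_X_pow_sub_C a (Nat.cast_ne_zero.mpr (Fact.out : p.Prime).ne_zero)
      (ne_zero_of_forall_pow_ne ha))⟩

theorem exists_generator [CharZero K] (hω : ω ^ p = algebraMap K L a) (ha : ∀ b : K, b ^ p ≠ a)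
    (hζ : IsPrimitiveRoot ζ p) (hE : IntermediateField.adjoin K {algebraMap L E ω, ζ} = ⊤) :
    ∃ σ : E ≃ₐ[K] E, σ (algebraMap L E ω) = ζ * algebraMap L E ω ∧ σ ζ = ζ := by
  obtain ⟨hfin, hgal⟩ := isGalois_radical hω ha hζ hE
  let F := IntermediateField.adjoin K {ζ}
  have hω' := algebraMap_radical_pow (E := E) hω
  have hζF : ζ ∈ F := IntermediateField.mem_adjoin_simple_self K ζ
  have hζint : IsIntegral K ζ := .of_finite K ζ
  have hp := (Fact.out : p.Prime)
  -- A `p`-th root of `a` has degree `p` over `K`, which cannot divide `[K(ζ) : K] ≤ p - 1`. Thus `X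
  -- ^ p - a` stays irreducible over `K(ζ)`.
  have haF : ∀ b : F, b ^ p ≠ algebraMap K F a := by
    intro b hb
    have h1 := minpoly.degree_dvd (IsIntegral.of_finite K b)
    rw [minpoly_radical hb ha, natDegree_X_pow_sub_C, IntermediateField.adjoin.finrank hζint] at h1
    have h2 : minpoly K ζ ∣ cyclotomic p K := by
      refine minpoly.dvd K ζ ?_
      rw [aeval_def, eval₂_eq_eval_map, map_cyclotomic]
      exact hζ.isRoot_cyclotomic hp.pos
    have h3 := natDegree_le_of_dvd h2 (cyclotomic_ne_zero p K)
    rw [natDegree_cyclotomic, Nat.totient_prime hp] at h3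
    have h4 := Nat.le_of_dvd (minpoly.natDegree_pos hζint) h1
    have := hp.pos
    omega
  have hωF : algebraMap L E ω ^ p = algebraMap F E (algebraMap K F a) := by
    rw [hω', ← IsScalarTower.algebraMap_apply]
  obtain ⟨σ, hσ⟩ := minpoly.exists_algEquiv_of_root' (K := F) (L := E)
    (x := ζ * algebraMap L E ω) (y := algebraMap L E ω)
    (isIntegral_radical hωF).isAlgebraic (by
      rw [minpoly_radical hωF haF]
      simp [mul_pow, hζ.pow_eq_one, hω', ← IsScalarTower.algebraMap_apply])
  exact ⟨σ.restrictScalars K, hσ, σ.commutes ⟨ζ, hζF⟩⟩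

omit [Algebra K L] [IsScalarTower K L E] in
theorem generator_pow_apply {σ : E ≃ₐ[K] E}
    (hσω : σ (algebraMap L E ω) = ζ * algebraMap L E ω) (hσζ : σ ζ = ζ) (i : ℕ) :
    (σ ^ i) (algebraMap L E ω) = ζ ^ i * algebraMap L E ω := by
  induction i with
  | zero => simp
  | succ i ih => rw [pow_succ', AlgEquiv.mul_apply, ih, map_mul, map_pow, hσω, hσζ]; ring

theorem generator_pow_eq_one [CharZero K] (hω : ω ^ p = algebraMap K L a)
    (ha : ∀ b : K, b ^ p ≠ a)
    (hζ : IsPrimitiveRoot ζ p) (hE : IntermediateField.adjoin K {algebraMap L E ω, ζ} = ⊤)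
    {σ : E ≃ₐ[K] E}
    (hσω : σ (algebraMap L E ω) = ζ * algebraMap L E ω) (hσζ : σ ζ = ζ) : σ ^ p = 1 := by
  obtain ⟨hfin, hgal⟩ := isGalois_radical hω ha hζ hE
  have h : ((σ ^ p : E ≃ₐ[K] E) : E →ₐ[K] E) = AlgHom.id K E := by
    refine algHom_ext_of_adjoin_eq_top hE ?_
    rintro y (rfl | rfl)
    · simp [generator_pow_apply hσω hσζ, hζ.pow_eq_one]
    · have : ∀ i : ℕ, (σ ^ i) y = y := by
        intro i
        induction i with
        | zero => rfl
        | succ i ih => rw [pow_succ', AlgEquiv.mul_apply, ih, hσζ]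
      exact this p
  exact AlgEquiv.ext fun y => DFunLike.congr_fun h y

theorem exists_apply_radical_eq (hω : ω ^ p = algebraMap K L a) (ha : ∀ b : K, b ^ p ≠ a)
    (hζ : IsPrimitiveRoot ζ p) (f : L →ₐ[K] E) :
    ∃ i : ℕ, f ω = ζ ^ i * algebraMap L E ω := by
  have hω' := algebraMap_radical_pow (E := E) hω
  have hω0 : algebraMap L E ω ≠ 0 := by simpa using radical_ne_zero hω ha
  have h1 : (f ω / algebraMap L E ω) ^ p = 1 := by
    rw [div_pow, ← map_pow, hω', hω, AlgHom.commutes, div_self]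
    rw [← hω']
    exact pow_ne_zero _ hω0
  obtain ⟨i, -, hi⟩ := hζ.eq_pow_of_pow_eq_one h1
  exact ⟨i, by rw [hi, div_mul_cancel₀ _ hω0]⟩

/-- Every element of `G` agrees on `L` with a power of `σ`, so an element of `L` fixed by `σ` is
fixed by all of `G`. -/
theorem mem_range_of_generator_fixed [CharZero K] (hω : ω ^ p = algebraMap K L a)
    (ha : ∀ b : K, b ^ p ≠ a)
    (hL : IntermediateField.adjoin K {ω} = ⊤)
    (hζ : IsPrimitiveRoot ζ p) (hE : IntermediateField.adjoin K {algebraMap L E ω, ζ} = ⊤)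
    {σ : E ≃ₐ[K] E}
    (hσω : σ (algebraMap L E ω) = ζ * algebraMap L E ω) (hσζ : σ ζ = ζ) {z : L}
    (hz : σ (algebraMap L E z) = algebraMap L E z) : ∃ k : K, z = algebraMap K L k := by
  obtain ⟨hfin, hgal⟩ := isGalois_radical hω ha hζ hE
  have hLfin := finite_radical hω ha hL
  have h1 (g : E ≃ₐ[K] E) : g (algebraMap L E z) = algebraMap L E z := by
    let ι := IsScalarTower.toAlgHom K L E
    obtain ⟨i, hi⟩ := exists_apply_radical_eq hω ha hζ ((g : E →ₐ[K] E).comp ι)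
    have h2 : (g : E →ₐ[K] E).comp ι = ((σ ^ i : E ≃ₐ[K] E) : E →ₐ[K] E).comp ι := by
      refine algHom_ext_of_adjoin_eq_top hL ?_
      rintro y rfl
      rw [hi]
      exact (generator_pow_apply hσω hσζ i).symm
    have h3 (i : ℕ) : (σ ^ i) (algebraMap L E z) = algebraMap L E z := by
      induction i with
      | zero => rfl
      | succ i ih => rw [pow_succ', AlgEquiv.mul_apply, ih, hz]
    exact (DFunLike.congr_fun h2 z).trans (h3 i)
  obtain ⟨k, hk⟩ := (IsGalois.mem_range_algebraMap_iff_fixed _).mpr h1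
  refine ⟨k, (algebraMap L E).injective ?_⟩
  rw [← hk, ← IsScalarTower.algebraMap_apply]

theorem natCard_algHom_radical [CharZero K] (hω : ω ^ p = algebraMap K L a)
    (ha : ∀ b : K, b ^ p ≠ a) (hL : IntermediateField.adjoin K {ω} = ⊤)
    (hζ : IsPrimitiveRoot ζ p) (hE : IntermediateField.adjoin K {algebraMap L E ω, ζ} = ⊤) :
    Nat.card (L →ₐ[K] E) = p := by
  obtain ⟨hfin, hgal⟩ := isGalois_radical hω ha hζ hE
  have hLfin := finite_radical hω ha hL
  rw [AlgHom.natCard_of_splits, finrank_radical hω ha hL]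
  intro y
  rw [← minpoly.algebraMap_eq (algebraMap L E).injective]
  exact Normal.splits inferInstance _

/-- An embedding `f` multiplies `ω ^ j` by a power of `ζ`, and both `ζ` and the coefficients `d f`
are fixed by `σ`; hence so is the ratio of `h · ω ^ j` to `ω ^ j`. -/
theorem act_radical_diagonal [CharZero K] (hω : ω ^ p = algebraMap K L a)
    (ha : ∀ b : K, b ^ p ≠ a)
    (hL : IntermediateField.adjoin K {ω} = ⊤)
    (hζ : IsPrimitiveRoot ζ p) (hE : IntermediateField.adjoin K {algebraMap L E ω, ζ} = ⊤)
    (T : HopfGaloisStructure.{u, v, w} K L) (h : T.H) (j : ℕ) :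
    ∃ k : K, T.act h (ω ^ j) = k • ω ^ j := by
  obtain ⟨hfin, hgal⟩ := isGalois_radical hω ha hζ hE
  have hLfin := finite_radical hω ha hL
  obtain ⟨σ, hσω, hσζ⟩ := exists_generator hω ha hζ hE
  have := Fintype.ofFinite (L →ₐ[K] E)
  obtain ⟨d, hd, hact⟩ := T.exists_fixed_coeff (generator_pow_eq_one hω ha hζ hE hσω hσζ)
    (natCard_algHom_radical hω ha hL hζ hE) (finrank_radical hω ha hL) h
  choose i hi using exists_apply_radical_eq (E := E) hω ha hζ
  have hω0 := radical_ne_zero hω ha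
  have hj : ω ^ j ≠ 0 := pow_ne_zero _ hω0
  have h1 : algebraMap L E (T.act h (ω ^ j)) =
      (∑ f, d f * (ζ ^ i f) ^ j) * algebraMap L E (ω ^ j) := by
    rw [hact, Finset.sum_mul]
    refine Finset.sum_congr rfl fun f _ => ?_
    rw [map_pow, hi, map_pow, mul_pow, mul_assoc]
  have h2 : algebraMap L E (T.act h (ω ^ j) / ω ^ j) = ∑ f, d f * (ζ ^ i f) ^ j := by
    rw [map_div₀, h1, mul_div_cancel_right₀]
    simpa using hj
  obtain ⟨k, hk⟩ := mem_range_of_generator_fixed hω ha hL hζ hE hσω hσζ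
    (z := T.act h (ω ^ j) / ω ^ j) (by simp [h2, hd, hσζ])
  exact ⟨k, by rw [Algebra.smul_def, ← hk, div_mul_cancel₀ _ hj]⟩

end Closure

/-! ### Fourier transform on a group of prime order -/

section Fourier

variable {p : ℕ} [Fact p.Prime] {N E : Type*} [Group N] [Finite N] [Field E]

/-- This is invertibility of the Vandermonde matrix on the `p` distinct values of `Ψ`. -/
theorem coeff_eq_of_sum_mul_pow_eq [Fintype N] (hcard : Nat.card N = p) {Ψ : N →* E}
    (hΨ : Function.Injective Ψ) {f g : N → E}
    (h : ∀ j : ZMod p, ∑ n, f n * Ψ n ^ j.val = ∑ n, g n * Ψ n ^ j.val) : f = g := by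
  let e : Fin p ≃ N := (Finite.equivFinOfCardEq hcard).symm
  have h1 : (fun i => f (e i) - g (e i)) = 0 := by
    refine Matrix.eq_zero_of_forall_pow_sum_mul_pow_eq_zero (f := fun i => Ψ (e i))
      (hΨ.comp e.injective) fun i => ?_
    have h2 := h (i : ℕ)
    rw [ZMod.val_natCast, Nat.mod_eq_of_lt i.2, ← sub_eq_zero, ← Finset.sum_sub_distrib,
      ← e.sum_comp] at h2
    simpa only [sub_mul] using h2
  funext n
  have h2 := congrFun h1 (e.symm n)
  simpa [sub_eq_zero] using h2

/-- The Fourier transform on the group algebra of a group of order `p`. -/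
noncomputable def fourierHom (p : ℕ) (Ψ : N →* E) :
    MonoidAlgebra E N →ₐ[E] GroupFunctions (ZMod p) E :=
  AlgHom.pi fun j => MonoidAlgebra.lift E E N (Ψ ^ j.val)

omit [Finite N] [Fact p.Prime] in
theorem eval_fourierHom (Ψ : N →* E) (j : ZMod p) (f : MonoidAlgebra E N) :
    GroupFunctions.eval j (fourierHom p Ψ f) = MonoidAlgebra.lift E E N (Ψ ^ j.val) f := rfl

omit [Finite N] [Fact p.Prime] in
theorem eval_fourierHom_eq_sum [Fintype N] (Ψ : N →* E) (j : ZMod p) (f : MonoidAlgebra E N) :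
    GroupFunctions.eval j (fourierHom p Ψ f) = ∑ n, f.coeff n * Ψ n ^ j.val := by
  rw [eval_fourierHom, MonoidAlgebra.lift_apply, Finsupp.sum_fintype _ _ (by simp)]
  rfl

theorem fourierHom_bijective (hcard : Nat.card N = p) {Ψ : N →* E} (hΨ : Function.Injective Ψ) :
    Function.Bijective (fourierHom p Ψ) := by
  have := Fintype.ofFinite N
  have hinj : Function.Injective (fourierHom p Ψ) := by
    intro f g hfg
    refine MonoidAlgebra.coeff_injective (DFunLike.coe_injective
      (coeff_eq_of_sum_mul_pow_eq hcard hΨ fun j => ?_))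
    rw [← eval_fourierHom_eq_sum, ← eval_fourierHom_eq_sum, hfg]
  have : Module.Finite E (MonoidAlgebra E N) := Module.Finite.of_basis (MonoidAlgebra.basis N E)
  refine ⟨hinj, (LinearMap.injective_iff_surjective_of_finrank_eq_finrank
    (f := (fourierHom p Ψ).toLinearMap) ?_).mp hinj⟩
  rw [Module.finrank_eq_card_basis (MonoidAlgebra.basis N E),
    Module.finrank_eq_card_basis (GroupFunctions.basis (ZMod p) E), ZMod.card,
    ← Nat.card_eq_fintype_card, hcard]

omit [Finite N] in
theorem counit_eq_eval_fourierHom (Ψ : N →* E) (f : MonoidAlgebra E N) :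
    Coalgebra.counit (R := E) f = GroupFunctions.eval (0 : ZMod p) (fourierHom p Ψ f) := by
  induction f using MonoidAlgebra.induction_linear with
  | zero => simp
  | add f g hf hg => rw [map_add, map_add, map_add, hf, hg]
  | single n c => simp [eval_fourierHom, MonoidAlgebra.counit_single]

-- Group elements are grouplike, and `Ψ ^ i * Ψ ^ j = Ψ ^ (i + j)`; reducing the exponent modulo `p`
-- is harmless as `n ^ p = 1`.
omit [Finite N] in
theorem evalPair_fourierHom_comul (hcard : Nat.card N = p) (Ψ : N →* E) (i j : ZMod p)
    (f : MonoidAlgebra E N) :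
    GroupFunctions.evalPair i j (TensorProduct.map (fourierHom p Ψ).toLinearMap
      (fourierHom p Ψ).toLinearMap (Coalgebra.comul (R := E) f)) =
      GroupFunctions.eval (i + j) (fourierHom p Ψ f) := by
  induction f using MonoidAlgebra.induction_linear with
  | zero => simp
  | add f g hf hg => simp only [map_add, hf, hg]
  | single n c =>
    have h1 : Ψ n ^ (i + j).val = Ψ n ^ i.val * Ψ n ^ j.val := by
      rw [← pow_add, ZMod.val_add]
      refine (pow_eq_pow_mod _ ?_).symm
      rw [← map_pow, ← hcard, pow_card_eq_one', map_one]
    simp [eval_fourierHom, MonoidAlgebra.comul_single, GroupFunctions.evalPair_tmul, h1,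
      mul_left_comm]

end Fourier

/-! ### Embedding the Hopf algebra in the group algebra -/

section Descent

variable {p : ℕ} [Fact p.Prime] {N : Type*} {K E : Type*} [Group N] [Finite N]
  [Field K] [Field E] [Algebra K E]
  {H : Type*} [Ring H] [Bialgebra K H]

/-- `φ` reads `e h` as an `E`-valued function and applies the inverse Fourier transform. All its
properties are checked on Fourier values. -/
theorem exists_algHom_fourier (hcard : Nat.card N = p) {Ψ : N →* E} (hΨ : Function.Injective Ψ)
    (e : H ≃ₐc[K] GroupFunctions (ZMod p) K) :
    ∃ φ : H →ₐ[K] MonoidAlgebra E N,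
      (∀ h j, GroupFunctions.eval j (fourierHom p Ψ (φ h)) =
        algebraMap K E (GroupFunctions.eval j (e h))) ∧
      Function.Injective φ ∧
      Set.range φ = {f | ∀ j, GroupFunctions.eval j (fourierHom p Ψ f) ∈
        Set.range (algebraMap K E)} ∧
      (∀ h, Coalgebra.counit (R := E) (φ h) =
        algebraMap K E (Coalgebra.counit (R := K) h)) ∧
      (∀ h, Coalgebra.comul (R := E) (φ h) =
        TensorProduct.mapOfCompatibleSMul E K K (MonoidAlgebra E N) (MonoidAlgebra E N)
          (TensorProduct.map φ.toLinearMap φ.toLinearMap (Coalgebra.comul (R := K) h))) := by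
  have hbij := fourierHom_bijective hcard hΨ
  let α := AlgEquiv.ofBijective (fourierHom p Ψ) hbij
  let ψ : H →ₐ[K] (ZMod p → E) := AlgHom.pi fun j =>
    (Algebra.ofId K E).comp ((GroupFunctions.eval j).comp (e : H →ₐ[K] GroupFunctions (ZMod p) K))
  let φ : H →ₐ[K] MonoidAlgebra E N :=
    { (α.symm : GroupFunctions (ZMod p) E →+* MonoidAlgebra E N).comp (ψ : H →+* (ZMod p → E)) with
      commutes' := fun k => by
        have h1 : ψ (algebraMap K H k) =
            algebraMap E (GroupFunctions (ZMod p) E) (algebraMap K E k) := by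
          rw [AlgHom.commutes]
          rfl
        change α.symm (ψ (algebraMap K H k)) = _
        rw [h1, AlgEquiv.commutes, ← IsScalarTower.algebraMap_apply] }
  have hφ (h : H) : fourierHom p Ψ (φ h) = ψ h := α.apply_symm_apply (ψ h)
  have hφj (h j) : GroupFunctions.eval j (fourierHom p Ψ (φ h)) =
        algebraMap K E (GroupFunctions.eval j (e h)) := by
    rw [hφ]
    rfl
  refine ⟨φ, hφj, ?_, ?_, ?_, ?_⟩
  · intro g h hgh
    have h1 : e g = e h := GroupFunctions.ext fun j => (algebraMap K E).injective (by
      rw [← hφj, ← hφj, hgh])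
    exact e.injective h1
  · ext f
    constructor
    · rintro ⟨h, rfl⟩ j
      exact ⟨_, (hφj h j).symm⟩
    · intro hf
      obtain ⟨k, hk⟩ : ∃ k : GroupFunctions (ZMod p) K, ∀ j,
          algebraMap K E (GroupFunctions.eval j k) = GroupFunctions.eval j (fourierHom p Ψ f) := by
        choose k hk using hf
        exact ⟨k, hk⟩
      refine ⟨e.symm k, hbij.1 (GroupFunctions.ext fun j => ?_)⟩
      rw [hφj, ← hk, BialgEquiv.apply_symm_apply]
  · intro h
    rw [counit_eq_eval_fourierHom (p := p) Ψ, hφj, ← GroupFunctions.counit_eq]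
    congr 1
    exact CoalgHomClass.counit_comp_apply e h
  · intro h
    have hinj : Function.Injective (TensorProduct.map (fourierHom p Ψ).toLinearMap
        (fourierHom p Ψ).toLinearMap) :=
      (TensorProduct.congr α.toLinearEquiv α.toLinearEquiv).injective
    refine hinj (GroupFunctions.tensor_ext fun i j => ?_)
    have key (z : H ⊗[K] H) : GroupFunctions.evalPair i j
        (TensorProduct.map (fourierHom p Ψ).toLinearMap (fourierHom p Ψ).toLinearMap
        (TensorProduct.mapOfCompatibleSMul E K K (MonoidAlgebra E N) (MonoidAlgebra E N)
          (TensorProduct.map φ.toLinearMap φ.toLinearMap z))) =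
        algebraMap K E (GroupFunctions.evalPair i j
          (TensorProduct.map (e : H →ₗ[K] _) (e : H →ₗ[K] _) z)) := by
      induction z with
      | zero => simp
      | tmul g h =>
        simp only [TensorProduct.map_tmul, TensorProduct.mapOfCompatibleSMul_tmul,
          GroupFunctions.evalPair_tmul, AlgHom.toLinearMap_apply, hφj, map_mul]
        rfl
      | add z w hz hw => simp only [map_add, hz, hw]
    rw [evalPair_fourierHom_comul hcard, key, hφj, ← GroupFunctions.evalPair_comul]
    congr 2
    exact (CoalgHomClass.map_comp_comul_apply e h).symm

end Descent

/-! ### Regular subgroups of prime order -/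

section RegularSubgroups

variable {X : Type*}

theorem IsRegularSubgroup.natCard_eq {N : Subgroup (Equiv.Perm X)} (hN : IsRegularSubgroup N)
    (s : X) : Nat.card N = Nat.card X := by
  refine Nat.card_eq_of_bijective (fun n : N => (n : Equiv.Perm X) s)
    ⟨fun m n hmn => ?_, fun t => ?_⟩
  · exact Subtype.ext ((hN s _).unique ⟨m.2, rfl⟩ ⟨n.2, hmn.symm⟩)
  · obtain ⟨n, ⟨hn, hnt⟩, -⟩ := hN s t
    exact ⟨⟨n, hn⟩, hnt⟩

/-- In a transitive commutative group, an element is determined by its value at one point. -/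
theorem isRegularSubgroup_zpowers {η : Equiv.Perm X} {s₀ : X}
    (h : ∀ s, ∃ i : ℤ, (η ^ i) s₀ = s) : IsRegularSubgroup (Subgroup.zpowers η) := by
  intro s t
  obtain ⟨i, rfl⟩ := h s
  obtain ⟨j, rfl⟩ := h t
  refine ⟨η ^ (j - i), ⟨⟨j - i, rfl⟩, ?_⟩, ?_⟩
  · rw [← Equiv.Perm.mul_apply, ← zpow_add, sub_add_cancel]
  · rintro _ ⟨⟨k, rfl⟩, hk⟩
    have h0 : (η ^ (k + i)) s₀ = (η ^ j) s₀ := by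
      rw [zpow_add, Equiv.Perm.mul_apply]
      exact hk
    refine Equiv.ext fun r => ?_
    obtain ⟨l, rfl⟩ := h r
    have h1 (m : ℤ) : (η ^ m) ((η ^ l) s₀) = (η ^ (l - i)) ((η ^ (m + i)) s₀) := by
      rw [← Equiv.Perm.mul_apply, ← zpow_add, ← Equiv.Perm.mul_apply, ← zpow_add]
      congr 2
      ring
    change (η ^ k) _ = _
    rw [h1, h1, h0, sub_add_cancel]

/-- Conjugation by `η` acts on the `p` elements of `N`, has trivial `p`-th iterate and fixes `1`, so
it is trivial. A permutation commuting with the regular group `⟨η⟩` agrees with the power of `η`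
that it matches at one point. -/
theorem IsRegularSubgroup.eq_zpowers {p : ℕ} [Fact p.Prime] {N : Subgroup (Equiv.Perm X)}
    (hN : IsRegularSubgroup N) {η : Equiv.Perm X} (hη : η ^ p = 1)
    (hreg : IsRegularSubgroup (Subgroup.zpowers η)) (s : X) (hcard : Nat.card X = p)
    (hconj : ∀ n ∈ N, η * n * η⁻¹ ∈ N) : N = Subgroup.zpowers η := by
  have hcardN := hN.natCard_eq s
  have hcardη := hreg.natCard_eq s
  have hX : Finite X := Nat.finite_of_card_ne_zero (hcard ▸ (Fact.out : p.Prime).ne_zero)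
  let f : N → N := fun n => ⟨η * n * η⁻¹, hconj n n.2⟩
  have hfp : f^[p] = id := by
    have h1 (k : ℕ) (n : N) : ((f^[k] n : N) : Equiv.Perm X) = η ^ k * n * (η ^ k)⁻¹ := by
      induction k with
      | zero => simp
      | succ k ih =>
        rw [Function.iterate_succ_apply']
        change η * _ * η⁻¹ = _
        rw [ih, pow_succ', mul_inv_rev]
        simp only [mul_assoc]
    funext n
    refine Subtype.ext ?_
    rw [h1, hη]
    simp
  have hcomm (n : Equiv.Perm X) (hn : n ∈ N) : Commute η n := by
    have h1 := eq_of_iterate_prime_of_fixed (hcardN.trans hcard) hfp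
      (x := 1) (Subtype.ext (by simp [f])) ⟨n, hn⟩
    have h2 : η * n * η⁻¹ = n := congrArg Subtype.val h1
    exact mul_inv_eq_iff_eq_mul.mp h2
  refine Subgroup.eq_of_le_of_card_ge (fun n hn => ?_) (hcardη.trans hcardN.symm).le
  obtain ⟨z, ⟨⟨i, rfl⟩, hz⟩, -⟩ := hreg s (n s)
  refine ⟨i, Equiv.ext fun t => ?_⟩
  obtain ⟨_, ⟨⟨j, rfl⟩, rfl⟩, -⟩ := hreg s t
  change (η ^ i) ((η ^ j) s) = n ((η ^ j) s)
  change (η ^ i) s = n s at hz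
  rw [← Equiv.Perm.mul_apply n, ← ((hcomm n hn).zpow_left j).eq, Equiv.Perm.mul_apply, ← hz,
    ← Equiv.Perm.mul_apply, ← Equiv.Perm.mul_apply, ← zpow_add, ← zpow_add, add_comm]

end RegularSubgroups

/-! ### The coset space and conjugation of the generator -/

section Cosets

variable {p : ℕ} [Fact p.Prime] {K : Type u} {L : Type v} {E : Type x} [Field K] [Field L]
  [Field E] [Algebra K L] [Algebra K E] [Algebra L E] [IsScalarTower K L E]
  {ω : L} {a : K} {ζ : E}

theorem leftTranslation_mk (g h : E ≃ₐ[K] E) :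
    leftTranslation K L E g (QuotientGroup.mk h) = QuotientGroup.mk (g * h) := rfl

theorem cosetApply_mk (g : E ≃ₐ[K] E) (y : L) :
    cosetApply (QuotientGroup.mk g : GalCosets K L E) y = g (algebraMap L E y) := rfl

theorem exists_algHom_cosetApply (q : GalCosets K L E) :
    ∃ f : L →ₐ[K] E, ∀ y, cosetApply q y = f y := by
  obtain ⟨g, rfl⟩ := QuotientGroup.mk_surjective q
  exact ⟨(g : E →ₐ[K] E).comp (IsScalarTower.toAlgHom K L E), fun y => rfl⟩

theorem mk_eq_mk_iff_apply_eq [Module.Finite K L] (hL : IntermediateField.adjoin K {ω} = ⊤)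
    (g h : E ≃ₐ[K] E) :
    (QuotientGroup.mk g : GalCosets K L E) = QuotientGroup.mk h ↔
      g (algebraMap L E ω) = h (algebraMap L E ω) := by
  constructor
  · intro hgh
    rw [← cosetApply_mk, hgh, cosetApply_mk]
  · intro hgh
    have h1 : (g : E →ₐ[K] E).comp (IsScalarTower.toAlgHom K L E) =
        (h : E →ₐ[K] E).comp (IsScalarTower.toAlgHom K L E) :=
      algHom_ext_of_adjoin_eq_top hL (by rintro _ rfl; exact hgh)
    refine QuotientGroup.eq.mpr ((IntermediateField.mem_fixingSubgroup_iff _ _).mpr ?_)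
    rintro _ ⟨y, rfl⟩
    have h2 : g (algebraMap L E y) = h (algebraMap L E y) := DFunLike.congr_fun h1 y
    change g⁻¹ (h (algebraMap L E y)) = algebraMap L E y
    rw [← h2, ← AlgEquiv.mul_apply, inv_mul_cancel, AlgEquiv.one_apply]

theorem exists_eq_mk_generator_pow (hω : ω ^ p = algebraMap K L a)
    (ha : ∀ b : K, b ^ p ≠ a) (hL : IntermediateField.adjoin K {ω} = ⊤)
    (hζ : IsPrimitiveRoot ζ p) {σ : E ≃ₐ[K] E}
    (hσω : σ (algebraMap L E ω) = ζ * algebraMap L E ω) (hσζ : σ ζ = ζ) (q : GalCosets K L E) :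
    ∃ i : ℕ, q = QuotientGroup.mk (σ ^ i) := by
  have hLfin := finite_radical hω ha hL
  obtain ⟨g, rfl⟩ := QuotientGroup.mk_surjective q
  obtain ⟨i, hi⟩ := exists_apply_radical_eq hω ha hζ
    ((g : E →ₐ[K] E).comp (IsScalarTower.toAlgHom K L E))
  exact ⟨i, (mk_eq_mk_iff_apply_eq hL _ _).mpr
    (hi.trans (generator_pow_apply hσω hσζ i).symm)⟩

theorem natCard_galCosets (hω : ω ^ p = algebraMap K L a)
    (ha : ∀ b : K, b ^ p ≠ a) (hL : IntermediateField.adjoin K {ω} = ⊤)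
    (hζ : IsPrimitiveRoot ζ p) {σ : E ≃ₐ[K] E}
    (hσω : σ (algebraMap L E ω) = ζ * algebraMap L E ω) (hσζ : σ ζ = ζ) (hσp : σ ^ p = 1) :
    Nat.card (GalCosets K L E) = p := by
  have hLfin := finite_radical hω ha hL
  have hω0 : algebraMap L E ω ≠ 0 := by simpa using radical_ne_zero hω ha
  rw [← Nat.card_fin p]
  refine (Nat.card_eq_of_bijective
    (fun i : Fin p => (QuotientGroup.mk (σ ^ (i : ℕ)) : GalCosets K L E))
    ⟨fun i j hij => ?_, fun q => ?_⟩).symm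
  · have h1 := (mk_eq_mk_iff_apply_eq hL _ _).mp hij
    rw [generator_pow_apply hσω hσζ, generator_pow_apply hσω hσζ] at h1
    exact Fin.ext (hζ.pow_inj i.2 j.2 (mul_right_cancel₀ hω0 h1))
  · obtain ⟨i, rfl⟩ := exists_eq_mk_generator_pow hω ha hL hζ hσω hσζ q
    refine ⟨⟨i % p, Nat.mod_lt _ (Fact.out : p.Prime).pos⟩, ?_⟩
    change (QuotientGroup.mk (σ ^ (i % p)) : GalCosets K L E) = _
    rw [← pow_eq_pow_mod _ hσp]

/-- One exponent `k` serves both claims: `g * σ` and `σ ^ k * g` agree on the generators `ω` and `ζ`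
of `E`. -/
theorem exists_conj_generator [CharZero K] (hω : ω ^ p = algebraMap K L a)
    (ha : ∀ b : K, b ^ p ≠ a)
    (hζ : IsPrimitiveRoot ζ p) (hE : IntermediateField.adjoin K {algebraMap L E ω, ζ} = ⊤)
    {σ : E ≃ₐ[K] E} (hσω : σ (algebraMap L E ω) = ζ * algebraMap L E ω) (hσζ : σ ζ = ζ)
    (g : E ≃ₐ[K] E) : ∃ k : ℕ, g ζ = ζ ^ k ∧ g * σ * g⁻¹ = σ ^ k := by
  obtain ⟨hfin, hgal⟩ := isGalois_radical hω ha hζ hE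
  obtain ⟨m, hm⟩ := exists_apply_radical_eq hω ha hζ
    ((g : E →ₐ[K] E).comp (IsScalarTower.toAlgHom K L E))
  replace hm : g (algebraMap L E ω) = ζ ^ m * algebraMap L E ω := hm
  obtain ⟨k, -, hk⟩ := hζ.eq_pow_of_pow_eq_one
    (show g ζ ^ p = 1 by rw [← map_pow, hζ.pow_eq_one, map_one])
  have hσkζ (i : ℕ) : (σ ^ i) ζ = ζ := by
    induction i with
    | zero => rfl
    | succ i ih => rw [pow_succ', AlgEquiv.mul_apply, ih, hσζ]
  have h : ((g * σ : E ≃ₐ[K] E) : E →ₐ[K] E) = ((σ ^ k * g : E ≃ₐ[K] E) : E →ₐ[K] E) := by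
    refine algHom_ext_of_adjoin_eq_top hE ?_
    rintro y (rfl | rfl)
    · change g (σ _) = (σ ^ k) (g _)
      rw [hσω, map_mul, hm, ← hk, map_mul, map_pow, hσkζ, generator_pow_apply hσω hσζ]
      ring
    · change g (σ _) = (σ ^ k) (g _)
      rw [hσζ, ← hk, map_pow, hσkζ]
  refine ⟨k, hk.symm, mul_inv_eq_iff_eq_mul.mpr ?_⟩
  exact AlgEquiv.ext fun y => DFunLike.congr_fun h y

end Cosets

/-! ### The Greither–Pareigis correspondence -/

section Correspondence

variable {p : ℕ} [Fact p.Prime] {K : Type u} {L : Type v} {E : Type x} [Field K] [Field L]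
  [Field E] [Algebra K L] [Algebra K E] [Algebra L E] [IsScalarTower K L E]
  {ω : L} {a : K} {ζ : E}

/-- `Ψ` sends the inverse of translation by `σ ^ i` to `ζ ^ i`. It is `G`-equivariant because
conjugation on `σ` and the Galois action on `ζ` have the same exponent. -/
theorem exists_translation_character [CharZero K] (hω : ω ^ p = algebraMap K L a)
    (ha : ∀ b : K, b ^ p ≠ a)
    (hζ : IsPrimitiveRoot ζ p) (hE : IntermediateField.adjoin K {algebraMap L E ω, ζ} = ⊤)
    {σ : E ≃ₐ[K] E} (hσω : σ (algebraMap L E ω) = ζ * algebraMap L E ω) (hσζ : σ ζ = ζ) :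
    ∃ Ψ : Subgroup.zpowers (leftTranslation K L E σ⁻¹) →* E, Function.Injective Ψ ∧
      (∀ n : Subgroup.zpowers (leftTranslation K L E σ⁻¹),
        cosetApply ((n : Equiv.Perm (GalCosets K L E))⁻¹
          (QuotientGroup.mk (1 : E ≃ₐ[K] E))) ω = Ψ n * algebraMap L E ω) ∧
      ∀ (g : E ≃ₐ[K] E) (n m : Subgroup.zpowers (leftTranslation K L E σ⁻¹)),
        (m : Equiv.Perm (GalCosets K L E)) =
          leftTranslation K L E g * n * (leftTranslation K L E g)⁻¹ → Ψ m = g (Ψ n) := by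
  have hσp := generator_pow_eq_one hω ha hζ hE hσω hσζ
  have hω0 : algebraMap L E ω ≠ 0 := by simpa using radical_ne_zero hω ha
  have hrep (n : Subgroup.zpowers (leftTranslation K L E σ⁻¹)) :
      ∃ i : ℕ, (n : Equiv.Perm (GalCosets K L E)) = (leftTranslation K L E (σ ^ i))⁻¹ := by
    have hfin : IsOfFinOrder (leftTranslation K L E σ⁻¹) :=
      isOfFinOrder_iff_pow_eq_one.mpr ⟨p, (Fact.out : p.Prime).pos, by
        rw [← map_pow, inv_pow, hσp, inv_one, map_one]⟩
    obtain ⟨i, hi⟩ := hfin.mem_powers_iff_mem_zpowers.mpr n.2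
    refine ⟨i, hi.symm.trans ?_⟩
    change leftTranslation K L E σ⁻¹ ^ i = _
    rw [← map_pow, inv_pow, map_inv]
  let ψ : Subgroup.zpowers (leftTranslation K L E σ⁻¹) → E := fun n =>
    cosetApply ((n : Equiv.Perm (GalCosets K L E))⁻¹
        (QuotientGroup.mk (1 : E ≃ₐ[K] E))) ω / algebraMap L E ω
  have hψ (n : Subgroup.zpowers (leftTranslation K L E σ⁻¹)) (i : ℕ)
      (hn : (n : Equiv.Perm (GalCosets K L E)) =
      (leftTranslation K L E (σ ^ i))⁻¹) : ψ n = ζ ^ i := by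
    change cosetApply _ _ / _ = _
    rw [hn, inv_inv, leftTranslation_mk, cosetApply_mk, mul_one, generator_pow_apply hσω hσζ,
      mul_div_cancel_right₀ _ hω0]
  let Ψ : Subgroup.zpowers (leftTranslation K L E σ⁻¹) →* E :=
    { toFun := ψ
      map_one' := by rw [hψ 1 0 (by simp), pow_zero]
      map_mul' := fun m n => by
        obtain ⟨i, hi⟩ := hrep m
        obtain ⟨j, hj⟩ := hrep n
        rw [hψ m i hi, hψ n j hj, hψ (m * n) (j + i), add_comm, pow_add]
        rw [Subgroup.coe_mul, hi, hj, pow_add, map_mul, mul_inv_rev] }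
  refine ⟨Ψ, ?_, fun n => (div_mul_cancel₀ _ hω0).symm, fun g n m hm => ?_⟩
  · refine (injective_iff_map_eq_one Ψ).mpr fun n hn => ?_
    obtain ⟨i, hi⟩ := hrep n
    have h1 : ζ ^ i = 1 := (hψ n i hi).symm.trans hn
    obtain ⟨k, rfl⟩ := (hζ.pow_eq_one_iff_dvd i).mp h1
    refine Subtype.ext ?_
    rw [hi, pow_mul, hσp, one_pow, map_one, inv_one, Subgroup.coe_one]
  · obtain ⟨i, hi⟩ := hrep n
    obtain ⟨k, hk, hconj⟩ := exists_conj_generator hω ha hζ hE hσω hσζ g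
    change ψ m = g (ψ n)
    rw [hψ n i hi, map_pow, hk, ← pow_mul]
    refine hψ m _ ?_
    rw [hm, hi, pow_mul, ← hconj, conj_pow, map_mul, map_mul, map_inv]
    group

theorem isRegularSubgroup_zpowers_leftTranslation (hω : ω ^ p = algebraMap K L a)
    (ha : ∀ b : K, b ^ p ≠ a) (hL : IntermediateField.adjoin K {ω} = ⊤)
    (hζ : IsPrimitiveRoot ζ p) {σ : E ≃ₐ[K] E}
    (hσω : σ (algebraMap L E ω) = ζ * algebraMap L E ω) (hσζ : σ ζ = ζ) :
    IsRegularSubgroup (Subgroup.zpowers (leftTranslation K L E σ⁻¹)) := by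
  refine isRegularSubgroup_zpowers (s₀ := QuotientGroup.mk 1) fun q => ?_
  obtain ⟨i, rfl⟩ := exists_eq_mk_generator_pow hω ha hL hζ hσω hσζ q
  refine ⟨-i, ?_⟩
  rw [← map_zpow, leftTranslation_mk, mul_one, inv_zpow, zpow_neg, inv_inv, zpow_natCast]

theorem normalizedByTranslations_zpowers [CharZero K] (hω : ω ^ p = algebraMap K L a)
    (ha : ∀ b : K, b ^ p ≠ a)
    (hζ : IsPrimitiveRoot ζ p) (hE : IntermediateField.adjoin K {algebraMap L E ω, ζ} = ⊤)
    {σ : E ≃ₐ[K] E} (hσω : σ (algebraMap L E ω) = ζ * algebraMap L E ω) (hσζ : σ ζ = ζ) :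
    NormalizedByTranslations (Subgroup.zpowers (leftTranslation K L E σ⁻¹)) := by
  rintro g _ ⟨i, rfl⟩
  obtain ⟨k, -, hconj⟩ := exists_conj_generator hω ha hζ hE hσω hσζ g
  refine ⟨k * i, ?_⟩
  change leftTranslation K L E σ⁻¹ ^ (k * i : ℤ) = leftTranslation K L E g *
    leftTranslation K L E σ⁻¹ ^ i * (leftTranslation K L E g)⁻¹
  rw [← map_zpow, ← map_zpow, ← map_inv, ← map_mul, ← map_mul, zpow_mul, zpow_natCast, inv_pow,
    ← hconj, conj_inv, conj_zpow]

/-- By equivariance of `Ψ`, applying `g` to the Fourier values of `f` gives those of the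
`g`-translate of `f`. Injectivity of the transform turns `G`-fixed elements into `G`-fixed values,
that is, values in `K`. -/
theorem fixedGroupAlgebra_eq [FiniteDimensional K E] [IsGalois K E]
    {N : Subgroup (Equiv.Perm (GalCosets K L E))} [Finite N] (hcard : Nat.card N = p)
    (hN : NormalizedByTranslations N) {Ψ : N →* E} (hΨ : Function.Injective Ψ)
    (hequiv : ∀ (g : E ≃ₐ[K] E) (n m : N), (m : Equiv.Perm (GalCosets K L E)) =
      leftTranslation K L E g * n * (leftTranslation K L E g)⁻¹ → Ψ m = g (Ψ n)) :
    fixedGroupAlgebra N = {f | ∀ j : ZMod p, GroupFunctions.eval j (fourierHom p Ψ f) ∈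
        Set.range (algebraMap K E)} := by
  have := Fintype.ofFinite N
  let c (g : E ≃ₐ[K] E) (n : N) : N :=
    ⟨leftTranslation K L E g * n * (leftTranslation K L E g)⁻¹, hN g n n.2⟩
  have hc (g : E ≃ₐ[K] E) : Function.Bijective (c g) := by
    refine Finite.injective_iff_bijective.mp fun m n hmn => Subtype.ext ?_
    exact mul_left_cancel (mul_right_cancel (congrArg Subtype.val hmn))
  have hg (f : MonoidAlgebra E N) (j : ZMod p) (g : E ≃ₐ[K] E) :
      g (GroupFunctions.eval j (fourierHom p Ψ f)) =
        ∑ n, g (f.coeff n) * Ψ (c g n) ^ j.val := by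
    rw [eval_fourierHom_eq_sum, map_sum]
    refine Finset.sum_congr rfl fun n _ => ?_
    rw [map_mul, map_pow, hequiv g n (c g n) rfl]
  have hsum (f : MonoidAlgebra E N) (j : ZMod p) (g : E ≃ₐ[K] E) :
      GroupFunctions.eval j (fourierHom p Ψ f) =
        ∑ n, f.coeff (c g n) * Ψ (c g n) ^ j.val := by
    rw [eval_fourierHom_eq_sum]
    exact ((hc g).sum_comp fun n => f.coeff n * Ψ n ^ j.val).symm
  ext f
  simp only [Set.mem_ofPred_eq, IsGalois.mem_range_algebraMap_iff_fixed]
  constructor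
  · intro hf j g
    rw [hg, hsum f j g]
    exact Finset.sum_congr rfl fun n _ => by rw [hf g n (c g n) rfl]
  · intro hf g n m hm
    obtain rfl : m = c g n := Subtype.ext hm
    let e := Equiv.ofBijective (c g) (hc g)
    have h1 : (fun m => g (f.coeff (e.symm m))) = fun m => f.coeff m := by
      refine coeff_eq_of_sum_mul_pow_eq hcard hΨ fun j => ?_
      rw [← eval_fourierHom_eq_sum, ← hf j g, hg, ← e.sum_comp]
      exact Finset.sum_congr rfl fun n _ => by rw [e.symm_apply_apply]; rfl
    have h2 := congrFun h1 (e n)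
    rw [← show e n = c g n from rfl, ← h2, e.symm_apply_apply]

theorem HopfGaloisStructure.correspondsTo_zpowers [CharZero K] (hω : ω ^ p = algebraMap K L a)
    (ha : ∀ b : K, b ^ p ≠ a) (hL : IntermediateField.adjoin K {ω} = ⊤)
    (hζ : IsPrimitiveRoot ζ p) (hE : IntermediateField.adjoin K {algebraMap L E ω, ζ} = ⊤)
    {σ : E ≃ₐ[K] E} (hσω : σ (algebraMap L E ω) = ζ * algebraMap L E ω) (hσζ : σ ζ = ζ)
    (T : HopfGaloisStructure.{u, v, w} K L) :
    T.CorrespondsTo (Subgroup.zpowers (leftTranslation K L E σ⁻¹)) := by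
  have hσp := generator_pow_eq_one hω ha hζ hE hσω hσζ
  obtain ⟨hfin, hgal⟩ := isGalois_radical hω ha hζ hE
  have hreg := isRegularSubgroup_zpowers_leftTranslation hω ha hL hζ hσω hσζ
  have hnorm : NormalizedByTranslations (Subgroup.zpowers (leftTranslation K L E σ⁻¹)) :=
    normalizedByTranslations_zpowers hω ha hζ hE hσω hσζ
  refine ⟨hreg, hnorm, ?_⟩
  have hcard := (hreg.natCard_eq (QuotientGroup.mk 1)).trans
    (natCard_galCosets hω ha hL hζ hσω hσζ hσp)
  have hN : Finite (Subgroup.zpowers (leftTranslation K L E σ⁻¹)) :=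
    Nat.finite_of_card_ne_zero (hcard ▸ (Fact.out : p.Prime).ne_zero)
  have := Fintype.ofFinite (Subgroup.zpowers (leftTranslation K L E σ⁻¹))
  obtain ⟨Ψ, hΨ, hΨω, hequiv⟩ := exists_translation_character hω ha hζ hE hσω hσζ
  obtain ⟨B, hB⟩ := exists_radical_basis hω ha hL
  obtain ⟨e, he⟩ := T.exists_bialgEquiv_of_diagonal B _ (by rw [hB, ZMod.val_zero, pow_zero])
    (fun i j => by rw [hB, hB, hB]; exact radical_pow_mul_pow hω i j)
    (fun h j => by rw [hB]; exact act_radical_diagonal hω ha hL hζ hE T h j.val)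
  obtain ⟨φ, hφ, hinj, hrange, hcounit, hcomul⟩ := exists_algHom_fourier (E := E) hcard hΨ e
  refine ⟨φ, hinj, ?_, hcounit, hcomul, fun h y => ?_⟩
  · rw [hrange, fixedGroupAlgebra_eq hcard hnorm hΨ hequiv]
  · rw [Finsupp.sum_fintype _ _ (by simp)]
    choose A hA using exists_algHom_cosetApply (K := K) (L := L) (E := E)
    simp only [hA] at hΨω ⊢
    suffices h1 : T.actInto E h = ∑ n, (φ h).coeff n •
        (A ((n : Equiv.Perm (GalCosets K L E))⁻¹ (QuotientGroup.mk 1))).toLinearMap by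
      rw [← T.actInto_apply, h1]
      simp
    -- On `ω ^ j` the embedding attached to `n` multiplies by `Ψ n ^ j`, so the sum over `n` is the
    -- `j`-th Fourier value of `φ h`, the eigenvalue of `h`.
    refine B.ext fun j => ?_
    have h2 := hφ h j
    rw [eval_fourierHom_eq_sum] at h2
    rw [T.actInto_apply, he, Algebra.smul_def, map_mul, ← IsScalarTower.algebraMap_apply, ← h2,
      Finset.sum_mul, LinearMap.sum_apply]
    refine Finset.sum_congr rfl fun n _ => ?_
    rw [LinearMap.smul_apply, AlgHom.toLinearMap_apply, hB, map_pow, map_pow, hΨω, mul_pow,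
      smul_eq_mul, mul_assoc]

end Correspondence

theorem mainTheorem6 (p : ℕ) (hp : p.Prime)
    (K : Type u) [Field K] [NumberField K]
    (hK : ∀ z : K, ¬ IsPrimitiveRoot z p)
    (L : Type v) [Field L] [Algebra K L]
    (ω : L) (a : K) (hω : ω ^ p = algebraMap K L a) (ha : ∀ b : K, b ^ p ≠ a)
    (hL : IntermediateField.adjoin K {ω} = ⊤)
    (E : Type x) [Field E] [Algebra K E] [Algebra L E] [IsScalarTower K L E]
    (ζ : E) (hζ : IsPrimitiveRoot ζ p)
    (hE : IntermediateField.adjoin K {algebraMap L E ω, ζ} = ⊤) :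
    (∃ S : HopfGaloisStructure.{u, v, u} K L,
      Module.Finite K S.H ∧ Coalgebra.IsCocomm K S.H ∧
      ∀ T : HopfGaloisStructure.{u, v, w} K L, S.Equivalent T) ∧
    ∃ σ : E ≃ₐ[K] E,
      σ (algebraMap L E ω) = ζ * algebraMap L E ω ∧ σ ζ = ζ ∧
      (∀ q : GalCosets K L E, ∃ i : ℤ, q = QuotientGroup.mk (σ ^ i)) ∧
      ∃ η : Equiv.Perm (GalCosets K L E),
        (∀ i : ℤ, η (QuotientGroup.mk (σ ^ i)) = QuotientGroup.mk (σ ^ (i - 1))) ∧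
        IsRegularSubgroup (Subgroup.zpowers η) ∧
        NormalizedByTranslations (Subgroup.zpowers η) ∧
        ∀ (T : HopfGaloisStructure.{u, v, w} K L)
          (N : Subgroup (Equiv.Perm (GalCosets K L E))),
          T.CorrespondsTo N ↔ N = Subgroup.zpowers η := by
  have : Fact p.Prime := ⟨hp⟩
  constructor
  · obtain ⟨B, hB⟩ := exists_radical_basis hω ha hL
    have h0 : B 0 = 1 := by rw [hB, ZMod.val_zero, pow_zero]
    have hmul (i j : ZMod p) : B i * B j = a ^ ((i.val + j.val) / p) • B (i + j) := by
      rw [hB, hB, hB]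
      exact radical_pow_mul_pow hω i j
    refine ⟨gradedHopfGaloisStructure B _ h0 hmul,
      inferInstanceAs (Module.Finite K (GroupFunctions (ZMod p) K)),
      inferInstanceAs (Coalgebra.IsCocomm K (GroupFunctions (ZMod p) K)), fun T => ?_⟩
    refine T.equivalent_of_diagonal B _ h0 hmul fun h j => ?_
    rw [hB]
    exact act_radical_diagonal hω ha hL hζ hE T h j.val
  · obtain ⟨σ, hσω, hσζ⟩ := exists_generator hω ha hζ hE
    have hσp := generator_pow_eq_one hω ha hζ hE hσω hσζ
    have hreg := isRegularSubgroup_zpowers_leftTranslation hω ha hL hζ hσω hσζ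
    have hcorr (T : HopfGaloisStructure.{u, v, w} K L) :
        T.CorrespondsTo (Subgroup.zpowers (leftTranslation K L E σ⁻¹)) :=
      T.correspondsTo_zpowers hω ha hL hζ hE hσω hσζ
    refine ⟨σ, hσω, hσζ, fun q => ?_, leftTranslation K L E σ⁻¹, fun i => ?_, hreg,
      normalizedByTranslations_zpowers hω ha hζ hE hσω hσζ, fun T N => ⟨fun hT => ?_, ?_⟩⟩
    · obtain ⟨i, hi⟩ := exists_eq_mk_generator_pow hω ha hL hζ hσω hσζ q
      exact ⟨i, by rw [hi, zpow_natCast]⟩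
    · rw [leftTranslation_mk, ← zpow_neg_one, ← zpow_add, neg_add_eq_sub]
    -- Here `η` is itself a left translation, so normalization by translations includes conjugation
    -- by `η`.
    · refine hT.1.eq_zpowers (p := p) ?_ hreg (QuotientGroup.mk 1)
        (natCard_galCosets hω ha hL hζ hσω hσζ hσp) fun n hn => hT.2.1 σ⁻¹ n hn
      rw [← map_pow, inv_pow, hσp, inv_one, map_one]
    · rintro rfl
      exact hcorr T
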